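/- Let $n_s,k_s,k_p$ be integers with $1\le k_s\le n_s$ and $k_p\ge 1$, let $0\le\delta<1$, and put $$\epsilon_p=\sum_{i=0}^{k_s-1}\binom{n_s}{i}\delta^{\,n_s-i}(1-\delta)^i .$$ Updates are generated by a Poisson process of rate $\lambda>0$ (updates per channel use). Each update is sent over a symbol erasure channel: successive symbols take one channel use each and are erased independently with probability $\delta$, independently for different updates and independently of the arrivals. Symbols are grouped into packets of $n_s$ symbols; a packet is decoded if at least $k_s$ of its symbols are not erased, and the service of an update ends when $k_p$ of its packets have been decoded (fixed redundancy HARQ). There is no buffer, and a newly generated update preempts the one in service (M/G/1/1 with preemption): an update is received iff its service time is smaller than the time until the next update is generated. The age at time $t$ is $\Delta(t)=t-u(t)$, where $u(t)$ is the generation time of the latest update received by time $t$ (and $u(t)=-a_0$ before the first reception, with $a_0\ge0$ an arbitrary initial age). Then: 1. The service time is $S=n_sM$ with $M$ negative binomial: $\mathbb P(M=k_p+m)=\binom{k_p+m-1}{k_p-1}(1-\epsilon_p)^{k_p}\epsilon_p^{\,m}$ for $m\ge 0$. Almost surely, the average age exists and equals $$\lim_{\tau\to\infty}\frac1\tau\int_0^\tau\Delta(t)\,dt=\Delta_{\mathrm{PFR}}(\lambda):=\frac1\lambda\left(\frac{1-e^{-\lambda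 n_s}\epsilon_p}{e^{-\lambda n_s}(1-\epsilon_p)}\right)^{k_p}.$$ 2. $\Delta_{\mathrm{PFR}}$ has exactly one minimizer $\lambda^*$ on $(0,\infty)$. It satisfies $\lambda^*\le\frac{1}{n_sk_p}$ and $e^{\lambda^* n_s}(k_pn_s\lambda^*-1)=-\epsilon_p$. 3. Let $\lambda_{\mathrm{FR}}=\dfrac{1-k_p+\sqrt{(k_p+1)^2-4k_p\epsilon_p}}{2n_sk_p}$. This is the only positive root of the equation $(1+\lambda n_s)(k_pn_s\lambda-1)=-\epsilon_p$, which arises from the equation for $\lambda^*$ by replacing $e^{\lambda n_s}$ with $1+\lambda n_s$; it approximates $\lambda^*$ in the sense that $$0\le\lambda^*-\lambda_{\mathrm{FR}}\le\frac{\epsilon_p}{k_p^2}\,\lambda^* .$$ 4. The minimum age $\Delta^*_{\mathrm{PFR}}=\Delta_{\mathrm{PFR}}(\lambda^*)$ satisfies $$\Delta^*_{\mathrm{PFR}}\ \ge\ \frac1{\lambda_{\mathrm{FR}}}\left(1+\frac{\lambda_{\mathrm{FR}}\,n_s}{1-\epsilon_p}\right)^{k_p}.$$ -/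

import Mathlib

open MeasureTheory ProbabilityTheory Filter Topology Finset

noncomputable section

namespace FRHARQ

/-- Packet erasure probability of an `(n_s, k_s)`-MDS code on a symbol erasure channel with
erasure rate `δ`: the probability that fewer than `k_s` of the `n_s` symbols are received. -/
def packetErasureProb (n_s k_s : ℕ) (δ : ℝ) : ℝ :=
  ∑ i ∈ Finset.range k_s, (n_s.choose i : ℝ) * δ ^ (n_s - i) * (1 - δ) ^ i

/-- `e j = true` means that the `j`-th symbol sent for an update is erased. Packet number `m`
consists of the symbols `m * n_s, …, m * n_s + n_s - 1`; it is decoded when at least `k_s` of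
them are not erased. -/
abbrev PacketDecoded (n_s k_s : ℕ) (e : ℕ → Bool) (m : ℕ) : Prop :=
  k_s ≤ #{j ∈ Finset.range n_s | e (m * n_s + j) = false}

/-- Number of packets that have to be sent until `k_p` of them are decoded. The set is nonempty
with probability one when the erasure rate is less than one. -/
def numPackets (n_s k_s k_p : ℕ) (e : ℕ → Bool) : ℕ :=
  sInf {m : ℕ | k_p ≤ #{l ∈ Finset.range m | PacketDecoded n_s k_s e l}}

/-- Service time, in channel uses: each packet takes `n_s` channel uses. -/
def serviceTime (n_s k_s k_p : ℕ) (e : ℕ → Bool) : ℝ :=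
  (n_s : ℝ) * (numPackets n_s k_s k_p e : ℝ)

/-- Generation time of update `i`, where `x 0` is the generation time of update `0` and `x (i + 1)`
is the time between the generation of update `i` and that of update `i + 1`. -/
def arrivalTime (x : ℕ → ℝ) (i : ℕ) : ℝ := ∑ j ∈ Finset.range (i + 1), x j

/-- Under preemption the service of update `i` starts when it is generated, and the update is
successfully received iff its service ends before the next update is generated. -/
def Successful (x s : ℕ → ℝ) (i : ℕ) : Prop := s i < x (i + 1)

/-- Generation time `u(t)` of the latest update that has been received by time `t`; it is `-a₀`
as long as nothing has been received (`a₀` is the age at time `0`). -/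
def lastReceived (x s : ℕ → ℝ) (a₀ t : ℝ) : ℝ :=
  sSup ({-a₀} ∪ {u : ℝ | ∃ i, Successful x s i ∧ arrivalTime x i + s i ≤ t ∧ u = arrivalTime x i})

/-- Instantaneous age `t - u(t)` in the M/G/1/1 system with preemption, for interarrival times `x`
and service times `s`. -/
def age (x s : ℕ → ℝ) (a₀ t : ℝ) : ℝ := t - lastReceived x s a₀ t

/-- Poisson arrivals of rate `lam` (i.i.d. exponential interarrival times `X i`) and, independently
of them, i.i.d. symbol erasures of probability `δ`: `E i j` tells whether the `j`-th symbol sent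
for update `i` is erased. -/
structure IsFRSystem {Ω : Type*} [MeasurableSpace Ω] (P : Measure Ω) (lam δ : ℝ)
    (X : ℕ → Ω → ℝ) (E : ℕ → ℕ → Ω → Bool) : Prop where
  measurable_X : ∀ i, Measurable (X i)
  law_X : ∀ i, P.map (X i) = expMeasure lam
  indep_X : iIndepFun X P
  measurable_E : ∀ i j, Measurable (E i j)
  prob_E : ∀ i j, P.real {ω | E i j ω = true} = δ
  indep_E : iIndepFun (fun p : ℕ × ℕ => E p.1 p.2) P
  indep_X_E : IndepFun (fun ω i => X i ω) (fun ω i j => E i j ω) P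

/-- The function `Δ_PFR` of the arrival rate, `ε` being the packet erasure probability. -/
def agePFR (n_s k_p : ℕ) (ε lam : ℝ) : ℝ :=
  1 / lam * ((1 - Real.exp (-lam * n_s) * ε) / (Real.exp (-lam * n_s) * (1 - ε))) ^ k_p

/-- The approximation `λ_FR` of the optimal arrival rate. -/
def rateFR (n_s k_p : ℕ) (ε : ℝ) : ℝ :=
  (1 - (k_p : ℝ) + √(((k_p : ℝ) + 1) ^ 2 - 4 * k_p * ε)) / (2 * n_s * k_p)

/-- `l` is an arrival rate that minimizes `Δ_PFR` among all positive rates. -/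
def IsOptimalRate (n_s k_p : ℕ) (ε l : ℝ) : Prop :=
  0 < l ∧ IsMinOn (agePFR n_s k_p ε) (Set.Ioi 0) l

end FRHARQ

end

/-! Average age. Let `A i` be the age just before update `i` is generated, `T i = min (S i) (X (i +
1))` its time in service and `F i` the indicator of preemption. The area under the age over one
interarrival time is `A i * T i + X (i + 1) ^ 2 / 2`, and `A (i + 1) = X (i + 1) + F i * A i`. With
`p = E[exp (-λ S)]`, exponential arrivals give `E[F i] = 1 - p` and `E[T i] = (1 - p) / λ`. Since `A
i` is independent of the pair `(F i, T i)`, a suitable combination `W i` of the centred variables,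
with `c = (1 - p) / (λ p)`, satisfies `A i * T i = A i * W i + c * (A i - A (i + 1)) + c * X (i +
1)`. The middle term telescopes and the products `A i * W i` are orthogonal with bounded second
moments, so their sum is negligible along the squares; nonnegativity of `A i * T i` fills the gaps.
The mean area per interarrival time is thus `c / λ + 1 / λ ^ 2 = 1 / (λ ^ 2 * p)`, and division by
the mean interarrival time gives `1 / (λ p)`. The negative binomial generating function turns this
into `agePFR`. Optimization. The derivative of `agePFR` is a positive factor times `exp (λ n) * (k n
λ - 1) + ε`, which is strictly increasing, so minimizers are exactly the positive roots. Comparing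
the equations of `λ*` and `λ_FR` (`root_comparison`) gives the error bound; inserting both equations
into the two ages turns the last bound into monotonicity (`agePFR_lower_bound`). -/

noncomputable section

namespace FRHARQ

/-! ### The optimal arrival rate and its linearized approximation -/

/-- The left-hand side of the optimality equation is strictly increasing on `[0, ∞)`. -/
lemma strictMonoOn_optimality {n k : ℝ} (hn : 0 < n) (hk : 1 ≤ k) :
    StrictMonoOn (fun l : ℝ => Real.exp (l * n) * (k * n * l - 1)) (Set.Ici 0) := by
  apply strictMonoOn_of_deriv_pos (convex_Ici 0) (by fun_prop)
  intro x hx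
  rw [interior_Ici, Set.mem_Ioi] at hx
  have h : HasDerivAt (fun l : ℝ => Real.exp (l * n) * (k * n * l - 1))
      (Real.exp (x * n) * (1 * n) * (k * n * x - 1) + Real.exp (x * n) * (k * n * 1)) x :=
    (((hasDerivAt_id x).mul_const n).exp).mul
      (((hasDerivAt_id x).const_mul (k * n)).sub_const 1)
  rw [h.deriv]
  have he := Real.exp_pos (x * n)
  have h1 : 0 < k * n * x := by positivity
  have : Real.exp (x * n) * (1 * n) * (k * n * x - 1) + Real.exp (x * n) * (k * n * 1)
      = Real.exp (x * n) * n * (k * n * x + (k - 1)) := by ring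
  rw [this]
  have : 0 < k * n * x + (k - 1) := by linarith
  positivity

lemma agePFR_eq (n k : ℕ) (ε l : ℝ) :
    agePFR n k ε l = 1 / l * ((Real.exp (l * n) - ε) / (1 - ε)) ^ k := by
  unfold agePFR
  congr 2
  have h : Real.exp (l * n) * Real.exp (-l * n) = 1 := by rw [← Real.exp_add]; simp
  have he := Real.exp_pos (-l * n)
  by_cases h0 : 1 - ε = 0
  · simp [h0]
  rw [div_eq_div_iff (by positivity) h0]
  linear_combination (-(1 - ε)) * h

/-- Factored so that, for positive rates, the first factor is positive and the optimality expression
alone decides the sign. -/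
lemma hasDerivAt_agePFR (n k : ℕ) (hk : 1 ≤ k) {ε l : ℝ} (hε : ε < 1) (hl : 0 < l) :
    HasDerivAt (agePFR n k ε)
      ((Real.exp (l * n) - ε) ^ (k - 1) / ((1 - ε) ^ k * l ^ 2) *
        (Real.exp (l * n) * (k * n * l - 1) + ε)) l := by
  obtain ⟨j, rfl⟩ := Nat.exists_eq_add_of_le' hk
  have hfun : agePFR n (j + 1) ε = fun l : ℝ => l⁻¹ * ((Real.exp (l * n) - ε) / (1 - ε)) ^ (j + 1) := by
    ext x; rw [agePFR_eq, one_div]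
  rw [hfun]
  have h1 := (hasDerivAt_inv hl.ne').mul
    ((((((hasDerivAt_id l).mul_const (n : ℝ)).exp).sub_const ε).div_const (1 - ε)).pow (j + 1))
  refine h1.congr_deriv ?_
  have h1e : 1 - ε ≠ 0 := by linarith
  simp only [id, Nat.add_sub_cancel, div_pow, Pi.pow_apply]
  field_simp
  push_cast
  ring

/-- Intermediate values on `[0, 1 / (n k)]`: the left side is `-1 < -ε` at `0` and `0 ≥ -ε` at the
right end. -/
lemma exists_root {n k ε : ℝ} (hn : 0 < n) (hk : 1 ≤ k) (hε0 : 0 ≤ ε) (hε1 : ε < 1) :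
    ∃ l : ℝ, 0 < l ∧ l ≤ 1 / (n * k) ∧ Real.exp (l * n) * (k * n * l - 1) = -ε := by
  have hk0 : 0 < k := by linarith
  have hcont : ContinuousOn (fun l : ℝ => Real.exp (l * n) * (k * n * l - 1))
      (Set.Icc 0 (1 / (n * k))) := by fun_prop
  have h := intermediate_value_Icc (by positivity : (0 : ℝ) ≤ 1 / (n * k)) hcont
  have hr : k * n * (1 / (n * k)) - 1 = 0 := by field_simp; ring
  have hmem : -ε ∈ Set.Icc (Real.exp (0 * n) * (k * n * 0 - 1))
      (Real.exp (1 / (n * k) * n) * (k * n * (1 / (n * k)) - 1)) := by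
    rw [hr]; constructor <;> simp <;> linarith
  obtain ⟨l, ⟨hl0, hl1⟩, hl⟩ := h hmem
  simp only at hl
  refine ⟨l, lt_of_le_of_ne hl0 ?_, hl1, hl⟩
  rintro rfl
  simp at hl
  linarith

lemma IsOptimalRate.equation {n k : ℕ} (hk : 1 ≤ k) {ε l : ℝ}
    (hε1 : ε < 1) (h : IsOptimalRate n k ε l) :
    Real.exp (l * n) * (k * n * l - 1) = -ε := by
  obtain ⟨hl, hmin⟩ := h
  have h0 := (hmin.isLocalMin (Ioi_mem_nhds hl)).hasDerivAt_eq_zero (hasDerivAt_agePFR n k hk hε1 hl)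
  have h1 : 1 ≤ Real.exp (l * n) := Real.one_le_exp (by positivity)
  have h2 : 0 < Real.exp (l * n) - ε := by linarith
  have h3 : 0 < 1 - ε := by linarith
  rcases mul_eq_zero.1 h0 with h | h
  · exact absurd h (by positivity)
  · linarith

/-- By strict monotonicity the derivative changes sign from minus to plus at the root, so the age
decreases before it and increases after it. -/
lemma isOptimalRate_of_equation {n k : ℕ} (hn : 1 ≤ n) (hk : 1 ≤ k) {ε l : ℝ}
    (hε1 : ε < 1) (hl : 0 < l)
    (h : Real.exp (l * n) * (k * n * l - 1) = -ε) : IsOptimalRate n k ε l := by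
  have hmono := strictMonoOn_optimality (n := n) (k := k) (by exact_mod_cast hn) (by exact_mod_cast hk)
  have hpos : ∀ x : ℝ, 0 < x → 0 ≤ (Real.exp (x * n) - ε) ^ (k - 1) / ((1 - ε) ^ k * x ^ 2) := by
    intro x hx
    have h1 : 1 ≤ Real.exp (x * n) := Real.one_le_exp (by positivity)
    have h2 : 0 < Real.exp (x * n) - ε := by linarith
    have h3 : 0 < 1 - ε := by linarith
    positivity
  have hcont : ContinuousOn (agePFR n k ε) (Set.Ioi 0) := fun x hx =>
    (hasDerivAt_agePFR n k hk hε1 hx).continuousAt.continuousWithinAt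
  have hanti : AntitoneOn (agePFR n k ε) (Set.Ioc 0 l) := by
    refine antitoneOn_of_deriv_nonpos (convex_Ioc 0 l) (hcont.mono fun x hx => hx.1) ?_ ?_
    · intro x hx
      rw [interior_Ioc] at hx
      exact (hasDerivAt_agePFR n k hk hε1 hx.1).differentiableAt.differentiableWithinAt
    · intro x hx
      rw [interior_Ioc] at hx
      rw [(hasDerivAt_agePFR n k hk hε1 hx.1).deriv]
      refine mul_nonpos_of_nonneg_of_nonpos (hpos x hx.1) ?_
      have := hmono hx.1.le hl.le hx.2
      simp only at this
      linarith
  have hmon : MonotoneOn (agePFR n k ε) (Set.Ici l) := by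
    refine monotoneOn_of_deriv_nonneg (convex_Ici l) (hcont.mono fun x hx => hl.trans_le hx) ?_ ?_
    · intro x hx
      rw [interior_Ici] at hx
      exact (hasDerivAt_agePFR n k hk hε1 (hl.trans hx)).differentiableAt.differentiableWithinAt
    · intro x hx
      rw [interior_Ici] at hx
      rw [(hasDerivAt_agePFR n k hk hε1 (hl.trans hx)).deriv]
      refine mul_nonneg (hpos x (hl.trans hx)) ?_
      have := hmono hl.le (hl.trans hx).le hx
      simp only at this
      linarith
  refine ⟨hl, fun x hx => ?_⟩
  rcases le_total x l with hxl | hxl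
  · exact hanti ⟨hx, hxl⟩ ⟨hl, le_rfl⟩ hxl
  · exact hmon Set.self_mem_Ici hxl hxl

theorem existsUnique_isOptimalRate {n k : ℕ} (hn : 1 ≤ n) (hk : 1 ≤ k) {ε : ℝ}
    (hε0 : 0 ≤ ε) (hε1 : ε < 1) : ∃! l : ℝ, IsOptimalRate n k ε l := by
  have hn' : (0 : ℝ) < n := by exact_mod_cast hn
  have hk' : (1 : ℝ) ≤ k := by exact_mod_cast hk
  obtain ⟨l, hl, -, h⟩ := exists_root hn' hk' hε0 hε1
  refine ⟨l, isOptimalRate_of_equation hn hk hε1 hl h, fun l' hl' => ?_⟩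
  exact (strictMonoOn_optimality hn' hk').injOn hl'.1.le hl.le ((hl'.equation hk hε1).trans h.symm)

theorem rateFR_iff {n k : ℕ} (hn : 1 ≤ n) (hk : 1 ≤ k) {ε : ℝ}
    (hε0 : 0 ≤ ε) (hε1 : ε < 1) (l : ℝ) :
    (0 < l ∧ (1 + l * n) * (k * n * l - 1) = -ε) ↔ l = rateFR n k ε := by
  have hn' : (0 : ℝ) < n := by exact_mod_cast hn
  have hk' : (1 : ℝ) ≤ k := by exact_mod_cast hk
  have hD : 0 ≤ ((k : ℝ) + 1) ^ 2 - 4 * k * ε := by nlinarith [sq_nonneg ((k : ℝ) - 1)]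
  have hs := Real.sq_sqrt hD
  have hs0 := Real.sqrt_nonneg (((k : ℝ) + 1) ^ 2 - 4 * k * ε)
  unfold rateFR
  set s := √(((k : ℝ) + 1) ^ 2 - 4 * k * ε) with hsdef
  rw [eq_div_iff (by positivity)]
  constructor
  · rintro ⟨hl, h⟩
    -- Completing the square; positivity of `l` then selects the nonnegative square root.
    have h1 : (2 * n * k * l + (k - 1)) ^ 2 = s ^ 2 := by
      rw [hs]; linear_combination (4 * (k : ℝ)) * h
    have h2 : 0 ≤ 2 * n * k * l + (k - 1) := by
      have : 0 ≤ 2 * n * k * l := by positivity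
      linarith
    have := (pow_left_inj₀ h2 hs0 two_ne_zero).1 h1
    linarith
  · intro h
    -- The discriminant exceeds `(k - 1) ^ 2` by `4 k (1 - ε) > 0`.
    have h1 : (k : ℝ) - 1 < s := by
      rw [hsdef]
      apply Real.lt_sqrt_of_sq_lt
      nlinarith
    constructor
    · have h3 : 0 < l * (2 * n * k) := by linarith
      exact pos_of_mul_pos_left h3 (by positivity)
    · have h4 : s = 2 * n * k * l + (k - 1) := by linarith
      rw [h4] at hs
      have : (4 * (k : ℝ)) * ((1 + l * n) * (k * n * l - 1)) = (4 * (k : ℝ)) * -ε := by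
        linear_combination hs
      exact mul_left_cancel₀ (by positivity) this

/-- After clearing denominators, the third-order Taylor bound for `exp x` is compared with `1 + x +
x ^ 2 / 2 * (1 + x) ^ 2`. -/
lemma inv_one_add_sub_exp_neg_le {x : ℝ} (hx0 : 0 ≤ x) (hx1 : x ≤ 1) :
    1 / (1 + x) - Real.exp (-x) ≤ x ^ 2 / 2 := by
  have h := Real.exp_bound' hx0 hx1 (n := 3) (by norm_num)
  simp [Finset.sum_range_succ, Nat.factorial] at h
  have h1 := Real.add_one_le_exp x
  rw [Real.exp_neg, ← one_div, div_sub_div _ _ (by positivity) (by positivity),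
    div_le_iff₀ (by positivity)]
  have h2 : x ^ 2 / 2 * ((1 + x) * (1 + x)) ≤ x ^ 2 / 2 * ((1 + x) * Real.exp x) := by
    gcongr; linarith
  nlinarith [pow_nonneg hx0 3, pow_nonneg hx0 4]

/-- Comparison of the optimality equation with its linearization, for `x = λ* n_s` and
`y = λ_FR n_s`. -/
lemma root_comparison {k ε x y : ℝ} (hk : 1 = k ∨ 2 ≤ k) (hε0 : 0 ≤ ε) (hε1 : ε < 1)
    (hx : 0 < x) (hy : 0 < y) (hxe : Real.exp x * (k * x - 1) = -ε)
    (hye : (1 + y) * (k * y - 1) = -ε) :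
    x ≤ 1 / k ∧ y ≤ x ∧ x - y ≤ ε / k ^ 2 * x := by
  have hk1 : 1 ≤ k := by rcases hk with h | h <;> linarith
  have hk0 : 0 < k := by linarith
  have hex := Real.exp_pos x
  have hkx : k * x ≤ 1 := by
    by_contra! h
    nlinarith [mul_pos hex (sub_pos.2 h)]
  have hky : k * y ≤ 1 := by
    by_contra! h
    nlinarith [mul_pos (by linarith : 0 < 1 + y) (sub_pos.2 h)]
  -- As `k y - 1 ≤ 0`, replacing `1 + y` with `exp y` can only lower the left side, so `y` does not
  -- lie beyond the root `x` of the increasing function.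
  have hyx : y ≤ x := by
    have hmono := strictMonoOn_optimality (n := 1) (k := k) one_pos hk1
    refine (hmono.le_iff_le (Set.mem_Ici.2 hy.le) (Set.mem_Ici.2 hx.le)).1 ?_
    simp only [mul_one]
    rw [hxe, ← hye]
    have := Real.add_one_le_exp y
    nlinarith
  have hT : k * (x - y) = ε * (1 / (1 + y) - Real.exp (-x)) := by
    have h1 : 1 - k * x = ε * Real.exp (-x) := by
      rw [Real.exp_neg]; field_simp; linarith
    have h2 : 1 - k * y = ε * (1 / (1 + y)) := by
      field_simp; linarith
    linarith
  set T := 1 / (1 + y) - Real.exp (-x) with hTdef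
  have hT0 : 0 ≤ T := by
    have h1 : Real.exp (-x) ≤ 1 / (1 + y) := by
      rw [Real.exp_neg, ← one_div]
      apply one_div_le_one_div_of_le (by linarith)
      linarith [Real.add_one_le_exp x]
    linarith
  -- For `k = 1`, `T ≤ 1 - (1 - x)`. For `k ≥ 2`, inserting `1 / (1 + x)` gives `T ≤ (x - y) + x ^ 2
  -- / 2`, while `k (x - y) = ε T ≤ T` gives `x - y ≤ T / 2`; hence `T ≤ x ^ 2` and `k T ≤ (k x) x ≤
  -- x`. Absorbing `x - y` in this way is what needs the gap between `1` and `2`.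
  have hTx : k * T ≤ x := by
    rcases hk with rfl | hk2
    · have h1 : 1 / (1 + y) ≤ 1 := by rw [div_le_one (by linarith)]; linarith
      have h2 := Real.add_one_le_exp (-x)
      linarith
    · have hx1 : x ≤ 1 := by nlinarith
      have h1 := inv_one_add_sub_exp_neg_le hx.le hx1
      have h2 : 1 / (1 + y) - 1 / (1 + x) ≤ x - y := by
        rw [div_sub_div _ _ (by positivity) (by positivity), div_le_iff₀ (by positivity)]
        nlinarith [mul_pos hx hy, mul_nonneg (sub_nonneg.2 hyx) (mul_pos hx hy).le,
          mul_nonneg (sub_nonneg.2 hyx) hx.le, mul_nonneg (sub_nonneg.2 hyx) hy.le]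
      have h3 : 2 * (x - y) ≤ T := by
        have : k * (x - y) ≤ T := by rw [hT]; nlinarith
        nlinarith
      have h4 : T ≤ x ^ 2 := by linarith
      nlinarith
  refine ⟨by rw [le_div_iff₀ hk0]; linarith, hyx, ?_⟩
  rw [div_mul_eq_mul_div, le_div_iff₀ (by positivity)]
  calc (x - y) * k ^ 2 = k * (k * (x - y)) := by ring
    _ = ε * (k * T) := by rw [hT]; ring
    _ ≤ ε * x := by gcongr

/-- By their equations, both bases are `k n / (1 - ε)` times `r (1 + r n)` and `l exp (l n)`
respectively. The factor `1 / r` or `1 / l` then cancels one power, leaving `r ^ (k - 1) (1 + r n) ^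
k ≤ l ^ (k - 1) exp (l n) ^ k`. -/
lemma agePFR_lower_bound {k : ℕ} (hk : 1 ≤ k) {n : ℕ} (hn : 1 ≤ n) {ε l r : ℝ} (hε1 : ε < 1)
    (hr : 0 < r) (hrl : r ≤ l)
    (hle : Real.exp (l * n) * (k * n * l - 1) = -ε) (hre : (1 + r * n) * (k * n * r - 1) = -ε) :
    1 / r * (1 + r * n / (1 - ε)) ^ k ≤ agePFR n k ε l := by
  obtain ⟨j, rfl⟩ := Nat.exists_eq_add_of_le' hk
  have hn' : (0 : ℝ) < n := by exact_mod_cast hn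
  have h1e : 0 < 1 - ε := by linarith
  have hl : 0 < l := hr.trans_le hrl
  rw [agePFR_eq]
  have e1 : (1 + r * n / (1 - ε)) = (((j + 1 : ℕ) : ℝ) * n / (1 - ε)) * (r * (1 + r * n)) := by
    field_simp; linear_combination -hre
  have e2 : (Real.exp (l * n) - ε) / (1 - ε)
      = (((j + 1 : ℕ) : ℝ) * n / (1 - ε)) * (l * Real.exp (l * n)) := by
    field_simp; linear_combination -hle
  rw [e1, e2]
  have e3 : ∀ (c a b : ℝ), 0 < a →
      1 / a * (c * (a * b)) ^ (j + 1) = c ^ (j + 1) * (a ^ j * b ^ (j + 1)) := by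
    intro c a b ha; field_simp; ring
  rw [e3 _ _ _ hr, e3 _ _ _ hl]
  have : 1 + r * n ≤ Real.exp (l * n) := by
    have := Real.add_one_le_exp (l * n)
    nlinarith
  gcongr

theorem optimalRate_bounds {n k : ℕ} (hn : 1 ≤ n) (hk : 1 ≤ k) {ε : ℝ}
    (hε0 : 0 ≤ ε) (hε1 : ε < 1) {l : ℝ} (h : IsOptimalRate n k ε l) :
    l ≤ 1 / (n * k) ∧
      Real.exp (l * n) * (k * n * l - 1) = -ε ∧
      rateFR n k ε ≤ l ∧
      l - rateFR n k ε ≤ ε / (k : ℝ) ^ 2 * l ∧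
      1 / rateFR n k ε * (1 + rateFR n k ε * n / (1 - ε)) ^ k ≤ agePFR n k ε l := by
  have hn' : (0 : ℝ) < n := by exact_mod_cast hn
  have hk' : (1 : ℝ) = k ∨ (2 : ℝ) ≤ k := by
    rcases hk.eq_or_lt with h | h
    · left; exact_mod_cast h
    · right; exact_mod_cast h
  have hk0 : (0 : ℝ) < k := by exact_mod_cast hk
  obtain ⟨hr, hre⟩ := (rateFR_iff hn hk hε0 hε1 _).2 rfl
  have he := h.equation hk hε1
  obtain ⟨h1, h2, h3⟩ := root_comparison (x := l * n) (y := rateFR n k ε * n) hk' hε0 hε1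
    (mul_pos h.1 hn') (mul_pos hr hn') (by rw [← he]; ring) (by rw [← hre]; ring)
  have h2' := le_of_mul_le_mul_right h2 hn'
  refine ⟨?_, he, h2', ?_, agePFR_lower_bound hk hn hε1 hr h2' he hre⟩
  · rw [le_div_iff₀ (by positivity)]
    rw [le_div_iff₀ hk0] at h1
    linarith
  · refine le_of_mul_le_mul_right ?_ hn'
    linarith

/-! ### Sample paths: area under the age -/

/-- The age just before the generation of update `i`. -/
def ageBefore (x s : ℕ → ℝ) (a₀ : ℝ) : ℕ → ℝ
  | 0 => a₀ + x 0
  | i + 1 => x (i + 1) + if s i < x (i + 1) then 0 else ageBefore x s a₀ i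

/-- The time that update `i` spends in service. -/
def timeInService (x s : ℕ → ℝ) (i : ℕ) : ℝ := min (s i) (x (i + 1))

section Pathwise

variable {x s : ℕ → ℝ} {a₀ : ℝ}

lemma arrivalTime_succ (x : ℕ → ℝ) (i : ℕ) :
    arrivalTime x (i + 1) = arrivalTime x i + x (i + 1) := Finset.sum_range_succ _ _

lemma strictMono_arrivalTime (hx : ∀ i, 0 < x i) : StrictMono (arrivalTime x) :=
  strictMono_nat_of_lt_succ fun i => by rw [arrivalTime_succ]; linarith [hx (i + 1)]

lemma arrivalTime_pos (hx : ∀ i, 0 < x i) (i : ℕ) : 0 < arrivalTime x i :=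
  Finset.sum_pos (fun j _ => hx j) ⟨0, by simp⟩

lemma ageBefore_nonneg (hx : ∀ i, 0 < x i) (ha : 0 ≤ a₀) (i : ℕ) : 0 ≤ ageBefore x s a₀ i := by
  induction i with
  | zero => exact add_nonneg ha (hx 0).le
  | succ i ih => rw [ageBefore]; have := hx (i + 1); split_ifs <;> linarith

lemma timeInService_nonneg (hx : ∀ i, 0 < x i) (hs : ∀ i, 0 ≤ s i) (i : ℕ) :
    0 ≤ timeInService x s i := le_min (hs i) (hx (i + 1)).le

/-- The generation times of the updates received by time `t`, together with `-a₀`. -/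
def receivedTimes (x s : ℕ → ℝ) (a₀ t : ℝ) : Set ℝ :=
  {-a₀} ∪ {u : ℝ | ∃ i, Successful x s i ∧ arrivalTime x i + s i ≤ t ∧ u = arrivalTime x i}

lemma bddAbove_receivedTimes (hs : ∀ i, 0 ≤ s i) (t : ℝ) :
    BddAbove (receivedTimes x s a₀ t) := by
  refine ⟨max (-a₀) t, ?_⟩
  rintro u (rfl | ⟨i, -, h, rfl⟩)
  · exact le_max_left _ _
  · exact le_max_of_le_right (by linarith [hs i])

lemma monotone_lastReceived (hs : ∀ i, 0 ≤ s i) : Monotone (lastReceived x s a₀) := by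
  intro t t' htt'
  refine csSup_le_csSup (bddAbove_receivedTimes hs t') ⟨-a₀, Or.inl rfl⟩ ?_
  rintro u (rfl | ⟨i, h1, h2, rfl⟩)
  · exact Or.inl rfl
  · exact Or.inr ⟨i, h1, h2.trans htt', rfl⟩

lemma intervalIntegrable_age (hs : ∀ i, 0 ≤ s i) (a b : ℝ) :
    IntervalIntegrable (age x s a₀) volume a b :=
  intervalIntegral.intervalIntegrable_id.sub (monotone_lastReceived hs).intervalIntegrable

lemma age_nonneg (hs : ∀ i, 0 ≤ s i) (ha : 0 ≤ a₀) {t : ℝ} (ht : 0 ≤ t) : 0 ≤ age x s a₀ t := by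
  refine sub_nonneg.2 (csSup_le ⟨-a₀, Or.inl rfl⟩ ?_)
  rintro u (rfl | ⟨i, -, h, rfl⟩)
  · linarith
  · linarith [hs i]

/-- This difference is the generation time of the freshest update received before update `i` is
generated (or `-a₀`). The recursion drives the two inductions below, which identify it as a greatest
element. -/
lemma arrivalTime_sub_ageBefore_succ (i : ℕ) :
    arrivalTime x (i + 1) - ageBefore x s a₀ (i + 1)
      = if s i < x (i + 1) then arrivalTime x i else arrivalTime x i - ageBefore x s a₀ i := by
  rw [arrivalTime_succ, ageBefore]; split_ifs <;> ring

lemma arrivalTime_sub_ageBefore_mem (i : ℕ) :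
    arrivalTime x i - ageBefore x s a₀ i = -a₀ ∨
      ∃ j < i, Successful x s j ∧ arrivalTime x i - ageBefore x s a₀ i = arrivalTime x j := by
  induction i with
  | zero => left; simp [arrivalTime, ageBefore]
  | succ i ih =>
    rw [arrivalTime_sub_ageBefore_succ]
    split_ifs with h
    · exact Or.inr ⟨i, i.lt_succ_self, h, rfl⟩
    · rcases ih with h | ⟨j, hj, h⟩
      · exact Or.inl h
      · exact Or.inr ⟨j, hj.trans i.lt_succ_self, h⟩

lemma le_arrivalTime_sub_ageBefore (hx : ∀ i, 0 < x i) (ha : 0 ≤ a₀) (i : ℕ) :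
    -a₀ ≤ arrivalTime x i - ageBefore x s a₀ i ∧
      ∀ j < i, Successful x s j → arrivalTime x j ≤ arrivalTime x i - ageBefore x s a₀ i := by
  induction i with
  | zero => simp [arrivalTime, ageBefore]
  | succ i ih =>
    rw [arrivalTime_sub_ageBefore_succ]
    split_ifs with h
    · refine ⟨by linarith [arrivalTime_pos hx i], fun j hj _ => ?_⟩
      exact (strictMono_arrivalTime hx).monotone (Nat.lt_succ_iff.1 hj)
    · refine ⟨ih.1, fun j hj hj' => ih.2 j ?_ hj'⟩
      refine lt_of_le_of_ne (Nat.lt_succ_iff.1 hj) ?_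
      rintro rfl
      exact h hj'

lemma le_of_received (hx : ∀ i, 0 < x i) (hs : ∀ i, 0 ≤ s i) {i j : ℕ} {t : ℝ}
    (ht : t < arrivalTime x (i + 1)) (h : arrivalTime x j + s j ≤ t) : j ≤ i := by
  by_contra! hij
  have := (strictMono_arrivalTime hx).monotone (Nat.succ_le_of_lt hij)
  have := hs j
  simp only [Nat.succ_eq_add_one] at *
  linarith

lemma age_before_first (hx : ∀ i, 0 < x i) (hs : ∀ i, 0 ≤ s i) {t : ℝ}
    (ht : t < arrivalTime x 0) : age x s a₀ t = t + a₀ := by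
  have : IsGreatest (receivedTimes x s a₀ t) (-a₀) := by
    refine ⟨Or.inl rfl, ?_⟩
    rintro u (rfl | ⟨i, -, h, rfl⟩)
    · exact le_rfl
    · have := (strictMono_arrivalTime hx).monotone (Nat.zero_le i)
      linarith [hs i]
  have h : lastReceived x s a₀ t = -a₀ := this.csSup_eq
  rw [age, h, sub_neg_eq_add]

lemma age_during_service (hx : ∀ i, 0 < x i) (hs : ∀ i, 0 ≤ s i) (ha : 0 ≤ a₀) {i : ℕ} {t : ℝ}
    (h1 : arrivalTime x i ≤ t) (h2 : t < arrivalTime x i + timeInService x s i) :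
    age x s a₀ t = t - (arrivalTime x i - ageBefore x s a₀ i) := by
  have h3 : t < arrivalTime x (i + 1) := by
    rw [arrivalTime_succ]; exact h2.trans_le (by gcongr; exact min_le_right _ _)
  have h4 : t < arrivalTime x i + s i := h2.trans_le (by gcongr; exact min_le_left _ _)
  have hle := le_arrivalTime_sub_ageBefore (s := s) hx ha i
  have : IsGreatest (receivedTimes x s a₀ t) (arrivalTime x i - ageBefore x s a₀ i) := by
    constructor
    · rcases arrivalTime_sub_ageBefore_mem (x := x) (s := s) (a₀ := a₀) i with h | ⟨j, hj, hj1, hj2⟩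
      · exact Or.inl h
      · refine Or.inr ⟨j, hj1, ?_, hj2⟩
        have h5 := (strictMono_arrivalTime hx).monotone (Nat.succ_le_of_lt hj)
        rw [Nat.succ_eq_add_one, arrivalTime_succ] at h5
        have : s j < x (j + 1) := hj1
        linarith
    · rintro u (rfl | ⟨j, hj, h, rfl⟩)
      · exact hle.1
      · refine hle.2 j (lt_of_le_of_ne (le_of_received hx hs h3 h) ?_) hj
        rintro rfl
        linarith
  have h : lastReceived x s a₀ t = _ := this.csSup_eq
  rw [age, h]

lemma age_after_service (hx : ∀ i, 0 < x i) (hs : ∀ i, 0 ≤ s i) (ha : 0 ≤ a₀) {i : ℕ} {t : ℝ}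
    (h1 : arrivalTime x i + timeInService x s i ≤ t) (h2 : t < arrivalTime x (i + 1)) :
    age x s a₀ t = t - arrivalTime x i := by
  have h2' := h2
  rw [arrivalTime_succ] at h2'
  -- The existence of such a `t` forces the update to be successful: an unsuccessful one is in
  -- service until the next arrival.
  have h3 : timeInService x s i < x (i + 1) := by linarith
  have h4 : s i < x (i + 1) := (min_lt_iff.1 h3).resolve_right (lt_irrefl _)
  rw [timeInService, min_eq_left h4.le] at h1
  have : IsGreatest (receivedTimes x s a₀ t) (arrivalTime x i) := by
    refine ⟨Or.inr ⟨i, h4, h1, rfl⟩, ?_⟩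
    rintro u (rfl | ⟨j, hj, h, rfl⟩)
    · linarith [arrivalTime_pos hx i]
    · exact (strictMono_arrivalTime hx).monotone (le_of_received hx hs h2 h)
  have h : lastReceived x s a₀ t = _ := this.csSup_eq
  rw [age, h]

lemma integral_age_of_eqOn {a b u : ℝ} (hab : a ≤ b)
    (h : ∀ t, a ≤ t → t < b → age x s a₀ t = t - u) :
    ∫ t in a..b, age x s a₀ t = (b ^ 2 - a ^ 2) / 2 - u * (b - a) := by
  have : ∫ t in a..b, age x s a₀ t = ∫ t in a..b, (t - u) := by
    -- The age may jump at the right endpoint, so the integral is moved to the half-open interval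
    -- `[a, b)`.
    rw [intervalIntegral.integral_of_le hab, intervalIntegral.integral_of_le hab,
      ← integral_Ico_eq_integral_Ioc, ← integral_Ico_eq_integral_Ioc]
    exact setIntegral_congr_fun measurableSet_Ico fun t ht => h t ht.1 ht.2
  rw [this, intervalIntegral.integral_sub intervalIntegral.intervalIntegrable_id
    intervalIntegrable_const, integral_id, intervalIntegral.integral_const, smul_eq_mul]
  ring

/-- The integral of the age over one interarrival time. -/
lemma integral_age_interarrival (hx : ∀ i, 0 < x i) (hs : ∀ i, 0 ≤ s i) (ha : 0 ≤ a₀) (i : ℕ) :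
    ∫ t in (arrivalTime x i)..(arrivalTime x (i + 1)), age x s a₀ t
      = ageBefore x s a₀ i * timeInService x s i + x (i + 1) ^ 2 / 2 := by
  -- Split at the end of service: the pieces are `A T + T ^ 2 / 2` and `(X ^ 2 - T ^ 2) / 2`, so the
  -- squares of `T` cancel.
  rw [← intervalIntegral.integral_add_adjacent_intervals
    (intervalIntegrable_age hs _ (arrivalTime x i + timeInService x s i))
    (intervalIntegrable_age hs _ _),
    integral_age_of_eqOn (by linarith [timeInService_nonneg hx hs i])
      (fun t => age_during_service hx hs ha),
    integral_age_of_eqOn (by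
        rw [arrivalTime_succ]; gcongr; exact min_le_right _ _)
      (fun t => age_after_service hx hs ha), arrivalTime_succ]
  ring

lemma integral_age_arrivalTime (hx : ∀ i, 0 < x i) (hs : ∀ i, 0 ≤ s i) (ha : 0 ≤ a₀) (N : ℕ) :
    ∫ t in (0 : ℝ)..(arrivalTime x N), age x s a₀ t
      = (x 0 ^ 2 / 2 + a₀ * x 0) + ∑ i ∈ Finset.range N,
          (ageBefore x s a₀ i * timeInService x s i + x (i + 1) ^ 2 / 2) := by
  induction N with
  | zero =>
    rw [integral_age_of_eqOn (u := -a₀) (arrivalTime_pos hx 0).le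
      (fun t _ ht => by rw [age_before_first hx hs ht]; ring)]
    simp [arrivalTime]
  | succ N ih =>
    rw [← intervalIntegral.integral_add_adjacent_intervals (intervalIntegrable_age hs 0 _)
      (intervalIntegrable_age hs _ _), ih, integral_age_interarrival hx hs ha,
      Finset.sum_range_succ]
    ring

/-- A monotone function that grows linearly along a sequence of epochs growing linearly. -/
lemma tendsto_div_of_tendsto_along {f : ℝ → ℝ} {T : ℕ → ℝ} {c μ : ℝ}
    (hf : MonotoneOn f (Set.Ici 0)) (hf0 : ∀ t, 0 ≤ t → 0 ≤ f t)
    (hT : StrictMono T) (hT0 : ∀ n, 0 < T n) (hμ : 0 < μ)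
    (hTμ : Tendsto (fun n : ℕ => T n / n) atTop (𝓝 μ))
    (hfc : Tendsto (fun n : ℕ => f (T n) / n) atTop (𝓝 c)) :
    Tendsto (fun t : ℝ => f t / t) atTop (𝓝 (c / μ)) := by
  have hTtop : Tendsto T atTop atTop := by
    have h := hTμ.pos_mul_atTop hμ (tendsto_natCast_atTop_atTop (R := ℝ))
    refine h.congr' ?_
    filter_upwards [eventually_gt_atTop 0] with n hn
    field_simp
  have hex : ∀ t : ℝ, ∃ n, t < T n := fun t => (hTtop.eventually_gt_atTop t).exists
  classical
  -- With `n = v t - 1` one has `T n ≤ t < T (n + 1)` for large `t`, which squeezes `f t / t`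
  -- between `f (T n) / T (n + 1)` and `f (T (n + 1)) / T n`.
  set v : ℝ → ℕ := fun t => Nat.find (hex t) with hv
  have hvtop : Tendsto v atTop atTop := by
    refine tendsto_atTop.2 fun n => ?_
    filter_upwards [eventually_ge_atTop (T n)] with t ht
    refine (Nat.le_find_iff _ _).2 fun m hm => ?_
    exact not_lt.2 (((hT hm).le).trans ht)
  have hw : Tendsto (fun t => v t - 1) atTop atTop := (tendsto_sub_atTop_nat 1).comp hvtop
  have hsucc : Tendsto (fun n : ℕ => ((n : ℝ) + 1) / n) atTop (𝓝 1) := by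
    have h := (tendsto_const_nhds (x := (1 : ℝ))).add (tendsto_inv_atTop_nhds_zero_nat (𝕜 := ℝ))
    rw [add_zero] at h
    refine h.congr' ?_
    filter_upwards [eventually_gt_atTop 0] with n hn
    field_simp
  have hT1 := hTμ.comp (tendsto_add_atTop_nat 1)
  have hf1 := hfc.comp (tendsto_add_atTop_nat 1)
  have hlow : Tendsto (fun n : ℕ => f (T n) / T (n + 1)) atTop (𝓝 (c / μ)) := by
    have h := (hfc.div hT1 hμ.ne').div hsucc one_ne_zero
    rw [div_one] at h
    refine h.congr' ?_
    filter_upwards [eventually_gt_atTop 0] with n hn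
    have := hT0 (n + 1)
    simp only [Function.comp, Pi.div_apply]
    push_cast
    field_simp
  have hup : Tendsto (fun n : ℕ => f (T (n + 1)) / T n) atTop (𝓝 (c / μ)) := by
    have h := (hf1.div hTμ hμ.ne').mul hsucc
    rw [mul_one] at h
    refine h.congr' ?_
    filter_upwards [eventually_gt_atTop 0] with n hn
    have := hT0 n
    simp only [Function.comp, Pi.div_apply]
    push_cast
    field_simp
  refine tendsto_of_tendsto_of_tendsto_of_le_of_le' (hlow.comp hw) (hup.comp hw) ?_ ?_
  all_goals
    filter_upwards [hvtop.eventually_ge_atTop 1, eventually_gt_atTop 0] with t ht ht0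
    obtain ⟨n, hn⟩ := Nat.exists_eq_add_of_le' ht
    have h1 : t < T (n + 1) := hn ▸ Nat.find_spec (hex t)
    have h2 : T n ≤ t := not_lt.1 (Nat.find_min (hex t) (show n < v t by omega))
    have h3 := hT0 n
    have h4 := hT0 (n + 1)
    simp only [Function.comp, hn, Nat.add_sub_cancel]
  · exact div_le_div₀ (hf0 t ht0.le) (hf h3.le ht0.le h2) ht0 h1.le
  · exact div_le_div₀ (hf0 _ h4.le) (hf ht0.le h4.le h1.le) h3 h2

/-- The age is nonnegative, so its integral is monotone and convergence along the arrival epochs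
suffices. -/
theorem tendsto_average_age (hx : ∀ i, 0 < x i) (hs : ∀ i, 0 ≤ s i) (ha : 0 ≤ a₀) {c μ : ℝ}
    (hμ : 0 < μ)
    (hTμ : Tendsto (fun n : ℕ => arrivalTime x n / n) atTop (𝓝 μ))
    (hc : Tendsto (fun n : ℕ => (∑ i ∈ Finset.range n,
      (ageBefore x s a₀ i * timeInService x s i + x (i + 1) ^ 2 / 2)) / (n : ℝ)) atTop (𝓝 c)) :
    Tendsto (fun τ : ℝ => 1 / τ * ∫ t in (0 : ℝ)..τ, age x s a₀ t) atTop (𝓝 (c / μ)) := by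
  have h := tendsto_div_of_tendsto_along (f := fun τ => ∫ t in (0 : ℝ)..τ, age x s a₀ t)
    (T := arrivalTime x) (c := c) ?_ ?_ (strictMono_arrivalTime hx) (arrivalTime_pos hx) hμ hTμ ?_
  · refine h.congr fun τ => ?_
    rw [one_div, div_eq_inv_mul]
  · intro a ha' b hb hab
    simp only
    rw [← intervalIntegral.integral_add_adjacent_intervals (intervalIntegrable_age hs 0 a)
      (intervalIntegrable_age hs a b)]
    have : 0 ≤ ∫ t in a..b, age x s a₀ t :=
      intervalIntegral.integral_nonneg hab fun t ht => age_nonneg hs ha (le_trans ha' ht.1)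
    linarith
  · intro t ht
    exact intervalIntegral.integral_nonneg ht fun u hu => age_nonneg hs ha hu.1
  · have h0 := (tendsto_const_div_atTop_nhds_zero_nat (𝕜 := ℝ) (x 0 ^ 2 / 2 + a₀ * x 0)).add hc
    rw [zero_add] at h0
    refine h0.congr fun n => ?_
    rw [integral_age_arrivalTime hx hs ha, ← add_div]

end Pathwise

/-! ### Independent families and binomial counts -/

section Independence

variable {Ω ι κ : Type*} {mΩ : MeasurableSpace Ω} {P : Measure Ω}

/-- A finite intersection splits into its left and right parts. This merges the interarrival times
and the erasures into one independent family. -/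
lemma iIndep_sumElim {m₁ : ι → MeasurableSpace Ω} {m₂ : κ → MeasurableSpace Ω}
    (h₁ : iIndep m₁ P) (h₂ : iIndep m₂ P) (h : Indep (⨆ i, m₁ i) (⨆ i, m₂ i) P) :
    iIndep (Sum.elim m₁ m₂) P := by
  rw [iIndep_iff]
  intro s f hf
  have hl : ∀ i ∈ s.toLeft, MeasurableSet[m₁ i] (f (Sum.inl i)) := fun i hi =>
    hf (Sum.inl i) (by simpa using hi)
  have hr : ∀ i ∈ s.toRight, MeasurableSet[m₂ i] (f (Sum.inr i)) := fun i hi =>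
    hf (Sum.inr i) (by simpa using hi)
  have hinter : ⋂ i ∈ s, f i
      = (⋂ i ∈ s.toLeft, f (Sum.inl i)) ∩ ⋂ i ∈ s.toRight, f (Sum.inr i) := by
    ext ω
    simp only [Set.mem_iInter, Set.mem_inter_iff, Finset.mem_toLeft, Finset.mem_toRight, Sum.forall]
  rw [hinter, (Indep_iff _ _ _).1 h _ _
    (Finset.measurableSet_biInter _ fun i hi => (le_iSup m₁ i) _ (hl i hi))
    (Finset.measurableSet_biInter _ fun i hi => (le_iSup m₂ i) _ (hr i hi)),
    h₁.meas_biInter hl, h₂.meas_biInter hr]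
  conv_rhs => rw [← Finset.toLeft_disjSum_toRight (u := s), Finset.prod_disjSum]

/-- Induction on the number of blocks: a new block is independent of the union of the earlier ones.
It is applied to the symbols grouped into packets. -/
lemma iIndep_iSup_of_pairwise_disjoint {m : ι → MeasurableSpace Ω} (h_le : ∀ i, m i ≤ mΩ)
    (h : iIndep m P) {S : κ → Set ι} (hS : Pairwise (Function.onFun Disjoint S)) :
    iIndep (fun k => ⨆ i ∈ S k, m i) P := by
  classical
  have := h.isProbabilityMeasure
  rw [iIndep_iff]
  intro s
  induction s using Finset.induction_on with
  | empty => simp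
  | insert a s ha ih =>
    intro f hf
    have h1 := indep_iSup_of_disjoint h_le h (S := S a) (T := ⋃ k ∈ s, S k)
      (Set.disjoint_iUnion₂_right.2 fun k hk => hS (by rintro rfl; exact ha hk))
    rw [Finset.set_biInter_insert, Finset.prod_insert ha,
      (Indep_iff _ _ _).1 h1 _ _ (hf a (by simp)), ih fun i hi => hf i (by simp [hi])]
    refine Finset.measurableSet_biInter _ fun k hk => ?_
    refine (biSup_mono (f := m) fun i hi => ?_ : (⨆ i ∈ S k, m i) ≤ _) _ (hf k (by simp [hk]))
    exact Set.mem_biUnion hk hi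

lemma measureReal_filter_eq {m : ι → MeasurableSpace Ω} (h_le : ∀ i, m i ≤ mΩ)
    (h : iIndep m P) {A : ι → Set Ω} (hA : ∀ i, MeasurableSet[m i] (A i)) {p : ℝ}
    (hp : ∀ i, P.real (A i) = p) [∀ i, DecidablePred fun ω => ω ∈ A i] {s t : Finset ι} (hts : t ⊆ s) :
    MeasurableSet {ω | {i ∈ s | ω ∈ A i} = t} ∧
    P.real {ω | {i ∈ s | ω ∈ A i} = t} = p ^ #t * (1 - p) ^ (#s - #t) := by
  classical
  have := h.isProbabilityMeasure
  have hset : {ω | {i ∈ s | ω ∈ A i} = t} = ⋂ i ∈ s, if i ∈ t then A i else (A i)ᶜ := by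
    ext ω
    simp only [Set.mem_iInter]
    constructor
    · rintro rfl i hi
      by_cases hω : ω ∈ A i <;> simp [hω, hi]
    · intro h
      ext i
      simp only [Finset.mem_filter]
      constructor
      · rintro ⟨hi, hω⟩
        by_contra hit
        have := h i hi
        simp [hit, hω] at this
      · intro hit
        have := h i (hts hit)
        simp only [hit, if_true] at this
        exact ⟨hts hit, this⟩
  have hm : ∀ i, MeasurableSet[m i] (if i ∈ t then A i else (A i)ᶜ) := by
    intro i; split_ifs
    · exact hA i
    · exact (hA i).compl
  rw [hset]
  refine ⟨Finset.measurableSet_biInter _ fun i _ => h_le i _ (hm i), ?_⟩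
  rw [measureReal_def, h.meas_biInter fun i _ => hm i, ENNReal.toReal_prod]
  have : ∀ i ∈ s, (P (if i ∈ t then A i else (A i)ᶜ)).toReal = if i ∈ t then p else 1 - p := by
    intro i _
    split_ifs
    · exact hp i
    · rw [← measureReal_def, probReal_compl_eq_one_sub (h_le i _ (hA i)), hp]
  rw [Finset.prod_congr rfl this, Finset.prod_ite, Finset.prod_const, Finset.prod_const,
    Finset.filter_mem_eq_inter, Finset.inter_eq_right.2 hts, Finset.filter_notMem_eq_sdiff,
    Finset.card_sdiff_of_subset hts]

/-- The binomial law: a disjoint union over the `j`-element sets of successful trials, each of the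
same probability. -/
lemma measurableSet_card_filter_eq {m : ι → MeasurableSpace Ω} (h_le : ∀ i, m i ≤ mΩ)
    (h : iIndep m P) {A : ι → Set Ω} (hA : ∀ i, MeasurableSet[m i] (A i)) {p : ℝ}
    (hp : ∀ i, P.real (A i) = p) [∀ i, DecidablePred fun ω => ω ∈ A i] (s : Finset ι) (j : ℕ) :
    MeasurableSet {ω | #{i ∈ s | ω ∈ A i} = j} ∧
    P.real {ω | #{i ∈ s | ω ∈ A i} = j} = (#s).choose j * (p ^ j * (1 - p) ^ (#s - j)) := by
  have := h.isProbabilityMeasure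
  have hset : {ω | #{i ∈ s | ω ∈ A i} = j}
      = ⋃ t ∈ s.powersetCard j, {ω | {i ∈ s | ω ∈ A i} = t} := by
    ext ω
    simp [Finset.mem_powersetCard, Finset.filter_subset]
  have hm := fun t (ht : t ∈ s.powersetCard j) =>
    measureReal_filter_eq h_le h hA hp (Finset.mem_powersetCard.1 ht).1
  rw [hset]
  refine ⟨Finset.measurableSet_biUnion _ fun t ht => (hm t ht).1, ?_⟩
  rw [measureReal_biUnion_finset ?_ fun t ht => (hm t ht).1]
  · rw [Finset.sum_congr rfl fun t ht => (hm t ht).2.trans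
      (by rw [(Finset.mem_powersetCard.1 ht).2]), Finset.sum_const, Finset.card_powersetCard,
      nsmul_eq_mul]
  · intro t _ t' _ htt'
    refine Set.disjoint_left.2 fun ω h1 h2 => htt' ?_
    exact (show _ = t from h1).symm.trans h2

/-- The number of successes before the trial `a`, which succeeds. -/
lemma measureReal_card_filter_eq_inter {m : ι → MeasurableSpace Ω} (h_le : ∀ i, m i ≤ mΩ)
    (h : iIndep m P) {A : ι → Set Ω} (hA : ∀ i, MeasurableSet[m i] (A i)) {p : ℝ}
    (hp : ∀ i, P.real (A i) = p) [∀ i, DecidablePred fun ω => ω ∈ A i] {s : Finset ι} {a : ι}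
    (ha : a ∉ s) (j : ℕ) :
    P.real ({ω | #{i ∈ s | ω ∈ A i} = j} ∩ A a)
      = (#s).choose j * (p ^ (j + 1) * (1 - p) ^ (#s - j)) := by
  classical
  have := h.isProbabilityMeasure
  have hset : {ω | #{i ∈ s | ω ∈ A i} = j} ∩ A a
      = ⋃ t ∈ s.powersetCard j, {ω | {i ∈ insert a s | ω ∈ A i} = insert a t} := by
    ext ω
    simp only [Set.mem_inter_iff, Set.mem_iUnion, Finset.mem_powersetCard]
    constructor
    · rintro ⟨h1, h2⟩
      refine ⟨{i ∈ s | ω ∈ A i}, ⟨Finset.filter_subset _ _, h1⟩, ?_⟩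
      show Finset.filter _ _ = _
      rw [Finset.filter_insert, if_pos h2]
    · rintro ⟨t, ⟨h1, h2⟩, h3⟩
      have h3 : {i ∈ insert a s | ω ∈ A i} = insert a t := h3
      have h4 : a ∈ ({i ∈ insert a s | ω ∈ A i} : Finset ι) := by
        rw [h3]; exact Finset.mem_insert_self a t
      replace h4 : ω ∈ A a := (Finset.mem_filter.1 h4).2
      refine ⟨?_, h4⟩
      rw [Finset.filter_insert, if_pos h4] at h3
      have h5 := congrArg Finset.card h3
      rw [Finset.card_insert_of_notMem (by simp [ha]),
        Finset.card_insert_of_notMem (fun h => ha (h1 h)), h2] at h5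
      exact Nat.succ_injective h5
  have hm := fun t (ht : t ∈ s.powersetCard j) =>
    measureReal_filter_eq h_le h hA hp
      (Finset.insert_subset_insert a (Finset.mem_powersetCard.1 ht).1)
  rw [hset, measureReal_biUnion_finset ?_ fun t ht => (hm t ht).1]
  · have hc : ∀ t ∈ s.powersetCard j, P.real {ω | {i ∈ insert a s | ω ∈ A i} = insert a t}
        = p ^ (j + 1) * (1 - p) ^ (#s - j) := by
      intro t ht
      have ht' := Finset.mem_powersetCard.1 ht
      rw [(hm t ht).2, Finset.card_insert_of_notMem ha,
        Finset.card_insert_of_notMem (fun h => ha (ht'.1 h)), ht'.2, Nat.add_sub_add_right]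
    rw [Finset.sum_congr rfl hc, Finset.sum_const, Finset.card_powersetCard, nsmul_eq_mul]
  · intro t ht t' ht' htt'
    refine Set.disjoint_left.2 fun ω h1 h2 => htt' ?_
    have h3 : insert a t = insert a t' := (show _ = insert a t from h1).symm.trans h2
    have h4 : a ∉ t := fun h => ha ((Finset.mem_powersetCard.1 ht).1 h)
    have h5 : a ∉ t' := fun h => ha ((Finset.mem_powersetCard.1 ht').1 h)
    rw [← Finset.erase_insert h4, h3, Finset.erase_insert h5]

end Independence

/-! ### Law and Laplace transform of the service time -/

section ServiceLaw

lemma packetErasureProb_nonneg {n_s k_s : ℕ} {δ : ℝ} (h0 : 0 ≤ δ) (h1 : δ < 1) :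
    0 ≤ packetErasureProb n_s k_s δ := by
  have : 0 ≤ 1 - δ := by linarith
  exact Finset.sum_nonneg fun i _ => by positivity

/-- In the expansion of `((1 - δ) + δ) ^ n_s = 1`, the sum omits at least the term `(1 - δ) ^ n_s >
0`. -/
lemma packetErasureProb_lt_one {n_s k_s : ℕ} (hkn : k_s ≤ n_s) {δ : ℝ} (h0 : 0 ≤ δ) (h1 : δ < 1) :
    packetErasureProb n_s k_s δ < 1 := by
  have h2 : 0 < 1 - δ := by linarith
  have h := add_pow (1 - δ) δ n_s
  rw [sub_add_cancel, one_pow, Finset.sum_range_succ] at h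
  have h3 : packetErasureProb n_s k_s δ
      ≤ ∑ i ∈ Finset.range n_s, (1 - δ) ^ i * δ ^ (n_s - i) * (n_s.choose i) := by
    unfold packetErasureProb
    rw [Finset.sum_congr rfl fun i _ => (by ring : (n_s.choose i : ℝ) * δ ^ (n_s - i) * (1 - δ) ^ i
      = (1 - δ) ^ i * δ ^ (n_s - i) * (n_s.choose i))]
    exact Finset.sum_le_sum_of_subset_of_nonneg (by simpa using hkn)
      fun i _ _ => by positivity
  have h4 : 0 < (1 - δ) ^ n_s := by positivity
  simp at h
  linarith

/-- The count of decoded packets grows by at most one per packet, so it first reaches `k_p` at a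
decoded packet preceded by exactly `k_p - 1`. Packets are numbered from `0`, so number `N` is the
`(N + 1)`-st. -/
lemma numPackets_eq_succ_iff {n_s k_s k_p : ℕ} (hkp : 1 ≤ k_p) (e : ℕ → Bool) (N : ℕ) :
    numPackets n_s k_s k_p e = N + 1 ↔
      #{l ∈ Finset.range N | PacketDecoded n_s k_s e l} = k_p - 1 ∧ PacketDecoded n_s k_s e N := by
  have hmono : Monotone fun m => #{l ∈ Finset.range m | PacketDecoded n_s k_s e l} :=
    fun a b hab => Finset.card_le_card (Finset.filter_subset_filter _ (by simpa using hab))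
  have hsucc : #{l ∈ Finset.range (N + 1) | PacketDecoded n_s k_s e l}
      = #{l ∈ Finset.range N | PacketDecoded n_s k_s e l}
        + if PacketDecoded n_s k_s e N then 1 else 0 := by
    rw [Finset.range_add_one, Finset.filter_insert]
    split_ifs
    · rw [Finset.card_insert_of_notMem (by simp)]
    · rfl
  constructor
  · intro h
    -- The infimum of the empty set is `0`, which differs from `N + 1`.
    have hne : {m : ℕ | k_p ≤ #{l ∈ Finset.range m | PacketDecoded n_s k_s e l}}.Nonempty := by
      by_contra! h0
      rw [numPackets, h0, Nat.sInf_empty] at h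
      omega
    have h1 := Nat.sInf_mem hne
    rw [← numPackets, h] at h1
    have h1 : k_p ≤ #{l ∈ Finset.range (N + 1) | PacketDecoded n_s k_s e l} := h1
    have h2 : ¬ k_p ≤ #{l ∈ Finset.range N | PacketDecoded n_s k_s e l} := fun h2 => by
      have : numPackets n_s k_s k_p e ≤ N := Nat.sInf_le h2
      omega
    by_cases hd : PacketDecoded n_s k_s e N
    · rw [hsucc, if_pos hd] at h1
      exact ⟨by omega, hd⟩
    · rw [hsucc, if_neg hd] at h1
      omega
  · rintro ⟨h1, h2⟩
    rw [if_pos h2, h1] at hsucc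
    have hmem : N + 1 ∈ {m : ℕ | k_p ≤ #{l ∈ Finset.range m | PacketDecoded n_s k_s e l}} := by
      show k_p ≤ _
      omega
    refine le_antisymm (Nat.sInf_le hmem) (le_csInf ⟨_, hmem⟩ fun m hm => ?_)
    by_contra! hlt
    have h3 := hmono (Nat.lt_succ_iff.1 hlt)
    have h4 : k_p ≤ #{l ∈ Finset.range m | PacketDecoded n_s k_s e l} := hm
    simp only at h3
    omega

lemma measurableSet_packetDecoded (n_s k_s l : ℕ) :
    MeasurableSet {e : ℕ → Bool | PacketDecoded n_s k_s e l} := by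
  have h : Measurable fun e : ℕ → Bool => #{j ∈ Finset.range n_s | e (l * n_s + j) = false} := by
    simp only [Finset.card_filter]
    refine Finset.measurable_sum _ fun j _ => ?_
    exact Measurable.ite (measurableSet_eq_fun (measurable_pi_apply _) measurable_const)
      measurable_const measurable_const
  exact h (measurableSet_Ici (a := k_s))

lemma measurable_numPackets {n_s k_s k_p : ℕ} (hkp : 1 ≤ k_p) :
    Measurable (numPackets n_s k_s k_p) := by
  have h : ∀ N, MeasurableSet (numPackets n_s k_s k_p ⁻¹' {N + 1}) := by
    intro N
    have : numPackets n_s k_s k_p ⁻¹' {N + 1}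
        = {e | #{l ∈ Finset.range N | PacketDecoded n_s k_s e l} = k_p - 1}
          ∩ {e | PacketDecoded n_s k_s e N} := by
      ext e; exact numPackets_eq_succ_iff hkp e N
    rw [this]
    refine MeasurableSet.inter ?_ (measurableSet_packetDecoded n_s k_s N)
    have h : Measurable fun e : ℕ → Bool => #{l ∈ Finset.range N | PacketDecoded n_s k_s e l} := by
      simp only [Finset.card_filter]
      refine Finset.measurable_sum _ fun j _ => ?_
      exact Measurable.ite (measurableSet_packetDecoded n_s k_s j)
        measurable_const measurable_const
    exact h (measurableSet_singleton (k_p - 1))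
  refine measurable_to_countable' fun N => ?_
  cases N with
  | succ N => exact h N
  | zero =>
    have : numPackets n_s k_s k_p ⁻¹' {0} = (⋃ N, numPackets n_s k_s k_p ⁻¹' {N + 1})ᶜ := by
      ext e
      simp only [Set.mem_preimage, Set.mem_singleton_iff, Set.mem_compl_iff, Set.mem_iUnion,
        not_exists]
      refine ⟨fun h N => by omega, fun h => ?_⟩
      by_contra h0
      exact h (numPackets n_s k_s k_p e - 1) (by omega)
    rw [this]
    exact (MeasurableSet.iUnion h).compl

/-- Packet `l` depends only on the symbols with index quotient `l`; these blocks are disjoint, hence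
the packets are independent. -/
lemma measurableSet_packetDecoded_comp {Ω : Type*} {e : ℕ → Ω → Bool} (n_s k_s l : ℕ) :
    MeasurableSet[⨆ j ∈ {j | j / n_s = l}, MeasurableSpace.comap (e j) ⊤]
      {ω | PacketDecoded n_s k_s (fun j => e j ω) l} := by
  set m : MeasurableSpace Ω := ⨆ j ∈ {j | j / n_s = l}, MeasurableSpace.comap (e j) ⊤ with hm
  have h : @Measurable _ _ m _ fun ω => #{j ∈ Finset.range n_s | e (l * n_s + j) ω = false} := by
    simp only [Finset.card_filter]
    refine Finset.measurable_sum _ fun j hj => ?_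
    have hj := Finset.mem_range.1 hj
    have he : @Measurable _ _ m ⊤ (e (l * n_s + j)) := by
      rw [measurable_iff_comap_le]
      refine le_iSup₂_of_le (f := fun j (_ : j ∈ {j | j / n_s = l}) =>
        MeasurableSpace.comap (e j) ⊤) (l * n_s + j) ?_ le_rfl
      show (l * n_s + j) / n_s = l
      rw [mul_comm, Nat.mul_add_div (by omega), Nat.div_eq_of_lt hj, add_zero]
    exact Measurable.ite (he (measurableSet_singleton false)) measurable_const measurable_const
  exact h (measurableSet_Ici (a := k_s))

variable {Ω : Type*} [mΩ : MeasurableSpace Ω] {P : Measure Ω}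

lemma measureReal_packetDecoded {n_s k_s : ℕ} {δ : ℝ} {e : ℕ → Ω → Bool}
    (he : ∀ j, Measurable (e j)) (hδ : ∀ j, P.real {ω | e j ω = true} = δ) (hi : iIndepFun e P)
    (l : ℕ) : P.real {ω | PacketDecoded n_s k_s (fun j => e j ω) l}
      = 1 - packetErasureProb n_s k_s δ := by
  have := hi.isProbabilityMeasure
  have hA : ∀ j, P.real {ω | e (l * n_s + j) ω = false} = 1 - δ := by
    intro j
    have : {ω | e (l * n_s + j) ω = false} = {ω | e (l * n_s + j) ω = true}ᶜ := by
      ext ω; simp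
    have hm : MeasurableSet {ω | e (l * n_s + j) ω = true} := he _ (measurableSet_singleton true)
    rw [this, probReal_compl_eq_one_sub hm, hδ]
  have hi' := (hi.precomp (add_right_injective (l * n_s)))
  rw [iIndepFun_iff_iIndep] at hi'
  have hb := measurableSet_card_filter_eq (A := fun j => {ω | e (l * n_s + j) ω = false})
    (fun j => (he (l * n_s + j)).comap_le) hi'
    (fun j => ⟨{false}, measurableSet_singleton _, rfl⟩) hA (Finset.range n_s)
  have hset : {ω | PacketDecoded n_s k_s (fun j => e j ω) l}ᶜ
      = ⋃ i ∈ Finset.range k_s, {ω | #{j ∈ Finset.range n_s |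
          ω ∈ {ω | e (l * n_s + j) ω = false}} = i} := by
    ext ω
    simp [PacketDecoded]
  have hD : MeasurableSet {ω | PacketDecoded n_s k_s (fun j => e j ω) l} :=
    (measurable_pi_iff.2 he) (measurableSet_packetDecoded n_s k_s l)
  rw [← compl_compl {ω | PacketDecoded n_s k_s (fun j => e j ω) l},
    probReal_compl_eq_one_sub hD.compl, hset, measureReal_biUnion_finset]
  · congr 1
    refine Finset.sum_congr rfl fun i _ => ?_
    rw [(hb i).2, Finset.card_range]
    ring
  · intro i _ j _ hij
    refine Set.disjoint_left.2 fun ω h1 h2 => hij ?_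
    exact (show _ = i from h1).symm.trans h2
  · exact fun i _ => (hb i).1

/-- The number of packets sent is negative binomial. -/
theorem measureReal_numPackets_eq {n_s k_s k_p : ℕ} (hkp : 1 ≤ k_p) {δ : ℝ}
    {e : ℕ → Ω → Bool}
    (he : ∀ j, Measurable (e j)) (hδ : ∀ j, P.real {ω | e j ω = true} = δ) (hi : iIndepFun e P)
    (m : ℕ) : P.real {ω | numPackets n_s k_s k_p (fun j => e j ω) = k_p + m}
      = ((k_p + m - 1).choose (k_p - 1) : ℝ) * (1 - packetErasureProb n_s k_s δ) ^ k_p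
        * packetErasureProb n_s k_s δ ^ m := by
  have hblock := iIndep_iSup_of_pairwise_disjoint (fun j => (he j).comap_le)
    ((iIndepFun_iff_iIndep _ _ _).1 hi) (S := fun l => {j | j / n_s = l})
    (fun a b hab => Set.disjoint_left.2 fun j h1 h2 => hab (h1.symm.trans h2))
  have h := measureReal_card_filter_eq_inter
    (A := fun l => {ω | PacketDecoded n_s k_s (fun j => e j ω) l})
    (fun l => iSup₂_le fun j _ => (he j).comap_le) hblock
    (fun l => measurableSet_packetDecoded_comp n_s k_s l)
    (measureReal_packetDecoded he hδ hi) (s := Finset.range (k_p + m - 1)) (a := k_p + m - 1)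
    (by simp) (k_p - 1)
  have hset : {ω | numPackets n_s k_s k_p (fun j => e j ω) = k_p + m}
      = {ω | #{l ∈ Finset.range (k_p + m - 1) |
          ω ∈ {ω | PacketDecoded n_s k_s (fun j => e j ω) l}} = k_p - 1}
        ∩ {ω | PacketDecoded n_s k_s (fun j => e j ω) (k_p + m - 1)} := by
    ext ω
    have := numPackets_eq_succ_iff (n_s := n_s) (k_s := k_s) hkp (fun j => e j ω) (k_p + m - 1)
    rw [show k_p + m - 1 + 1 = k_p + m by omega] at this
    exact this
  rw [hset, h, Finset.card_range, show k_p - 1 + 1 = k_p by omega,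
    show k_p + m - 1 - (k_p - 1) = m by omega, sub_sub_cancel, mul_assoc]

/-- The Laplace transform of the negative binomial distribution. -/
theorem integral_exp_neg_serviceTime {n_s k_s k_p : ℕ} (hn : 1 ≤ n_s) (hkn : k_s ≤ n_s)
    (hkp : 1 ≤ k_p)
    {δ : ℝ} (h0 : 0 ≤ δ) (h1 : δ < 1) {e : ℕ → Ω → Bool}
    (he : ∀ j, Measurable (e j)) (hδ : ∀ j, P.real {ω | e j ω = true} = δ) (hi : iIndepFun e P)
    {lam : ℝ} (hlam : 0 < lam) :
    ∫ ω, Real.exp (-(lam * serviceTime n_s k_s k_p (fun j => e j ω))) ∂P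
      = ((Real.exp (-lam * n_s) * (1 - packetErasureProb n_s k_s δ))
          / (1 - Real.exp (-lam * n_s) * packetErasureProb n_s k_s δ)) ^ k_p := by
  have := hi.isProbabilityMeasure
  set ε := packetErasureProb n_s k_s δ with hε
  have hε0 : 0 ≤ ε := packetErasureProb_nonneg h0 h1
  have hε1 : ε < 1 := packetErasureProb_lt_one hkn h0 h1
  set z := Real.exp (-lam * n_s) with hz
  have hz0 : 0 < z := Real.exp_pos _
  have hz1 : z ≤ 1 := by
    rw [hz, Real.exp_le_one_iff]
    have : 0 ≤ lam * n_s := by positivity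
    linarith
  set M : Ω → ℕ := fun ω => numPackets n_s k_s k_p (fun j => e j ω) with hM
  have hMm : Measurable M := (measurable_numPackets hkp).comp (measurable_pi_iff.2 he)
  have hlaw : ∀ m, (P.map M).real {k_p + m}
      = ((m + (k_p - 1)).choose (k_p - 1) : ℝ) * (1 - ε) ^ k_p * ε ^ m := by
    intro m
    rw [map_measureReal_apply hMm (measurableSet_singleton _)]
    refine (measureReal_numPackets_eq (k_s := k_s) (n_s := n_s) hkp he hδ hi m).trans ?_
    rw [show k_p + m - 1 = m + (k_p - 1) by omega]
  have hprob : IsProbabilityMeasure (P.map M) := Measure.isProbabilityMeasure_map hMm.aemeasurable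
  have hser : ∀ w : ℝ, 0 ≤ w → w ≤ 1 →
      HasSum (fun m => (P.map M).real {k_p + m} * w ^ (k_p + m))
        (((w * (1 - ε)) / (1 - w * ε)) ^ k_p) := by
    intro w hw0 hw1
    have hwε : ‖w * ε‖ < 1 := by
      rw [Real.norm_of_nonneg (by positivity)]
      nlinarith
    -- The negative binomial series with sum `(1 - w ε) ^ (-k_p)`.
    have h := (hasSum_choose_mul_geometric_of_norm_lt_one (k_p - 1) hwε).mul_left
      ((w * (1 - ε)) ^ k_p)
    rw [show k_p - 1 + 1 = k_p by omega] at h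
    convert! h using 1
    · ext m; rw [hlaw, mul_pow, mul_pow, pow_add]; ring
    · rw [div_pow]; ring
  have hint : ∀ w : ℝ, 0 ≤ w → w ≤ 1 → Integrable (fun j : ℕ => w ^ j) (P.map M) := by
    intro w hw0 hw1
    refine Integrable.of_bound (C := 1) (by fun_prop) (Eventually.of_forall fun j => ?_)
    rw [Real.norm_of_nonneg (by positivity)]
    exact pow_le_one₀ hw0 hw1
  have htot : ∀ w : ℝ, 0 ≤ w → w ≤ 1 → ∫ j, w ^ j ∂(P.map M)
      = ∑ j ∈ Finset.range k_p, (P.map M).real {j} * w ^ j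
        + ((w * (1 - ε)) / (1 - w * ε)) ^ k_p := by
    intro w hw0 hw1
    rw [integral_countable (hint w hw0 hw1), ← (hser w hw0 hw1).tsum_eq]
    simp only [smul_eq_mul]
    have hs : Summable fun j => (P.map M).real {j} * w ^ j := by
      rw [← summable_nat_add_iff k_p]
      simpa [add_comm] using (hser w hw0 hw1).summable
    rw [← hs.sum_add_tsum_nat_add k_p]
    simp only [add_comm]
  -- At `w = 1` the values from `k_p` on already carry total mass one. This also discards the
  -- default value `0` taken when `k_p` packets are never decoded.
  have hzero : ∀ j ∈ Finset.range k_p, (P.map M).real {j} = 0 := by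
    have h := htot 1 zero_le_one le_rfl
    have h1e : 1 - ε ≠ 0 := by linarith
    simp only [one_pow, integral_const, probReal_univ, one_mul, smul_eq_mul, mul_one,
      div_self h1e] at h
    have : ∑ j ∈ Finset.range k_p, (P.map M).real {j} = 0 := by linarith
    exact (Finset.sum_eq_zero_iff_of_nonneg fun _ _ => measureReal_nonneg).1 this
  have hfun : ∀ ω, Real.exp (-(lam * serviceTime n_s k_s k_p (fun j => e j ω))) = z ^ (M ω) := by
    intro ω
    rw [hz, ← Real.exp_nat_mul, serviceTime]
    congr 1
    ring
  simp only [hfun]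
  have := htot z hz0.le hz1
  rw [Finset.sum_eq_zero (fun j hj => by rw [hzero j hj, zero_mul]), zero_add] at this
  rw [← this, integral_map hMm.aemeasurable (by fun_prop)]

end ServiceLaw

/-! ### Exponential interarrival times against an independent service time -/

section Exponential

lemma integral_expMeasure {r : ℝ} (hr : 0 < r) (g : ℝ → ℝ) :
    ∫ x, g x ∂(expMeasure r) = ∫ x in Set.Ioi 0, r * Real.exp (-(r * x)) * g x := by
  have h : expMeasure r = volume.withDensity (exponentialPDF r) := rfl
  rw [h, integral_withDensity_eq_integral_toReal_smul
    (by unfold exponentialPDF; fun_prop) (Eventually.of_forall fun x => by simp [exponentialPDF]),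
    ← integral_Ici_eq_integral_Ioi, ← integral_indicator measurableSet_Ici]
  congr 1
  ext x
  rw [exponentialPDF_eq]
  by_cases hx : 0 ≤ x
  · rw [Set.indicator_of_mem (Set.mem_Ici.2 hx), if_pos hx,
      ENNReal.toReal_ofReal (by positivity), smul_eq_mul]
  · rw [Set.indicator_of_notMem (by simpa using hx), if_neg hx]
    simp

lemma integral_id_expMeasure {r : ℝ} (hr : 0 < r) : ∫ x, x ∂(expMeasure r) = 1 / r := by
  rw [integral_expMeasure hr]
  have h := Real.integral_rpow_mul_exp_neg_mul_Ioi (a := 2) two_pos hr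
  rw [show (2 : ℝ) - 1 = 1 by norm_num, show (2 : ℝ) = (1 : ℕ) + 1 by norm_num,
    Real.Gamma_nat_eq_factorial] at h
  simp_rw [mul_assoc, integral_const_mul]
  rw [← setIntegral_congr_fun (f := fun t : ℝ => t ^ (1 : ℝ) * Real.exp (-(r * t)))
    measurableSet_Ioi (fun x _ => by simp only [Real.rpow_one]; ring), h,
    show ((1 : ℕ) : ℝ) + 1 = (2 : ℕ) by norm_num, Real.rpow_natCast]
  field_simp
  simp

lemma integral_sq_expMeasure {r : ℝ} (hr : 0 < r) :
    ∫ x, x ^ 2 ∂(expMeasure r) = 2 / r ^ 2 := by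
  rw [integral_expMeasure hr]
  have h := Real.integral_rpow_mul_exp_neg_mul_Ioi (a := 3) three_pos hr
  rw [show (3 : ℝ) - 1 = (2 : ℕ) by norm_num, show (3 : ℝ) = (2 : ℕ) + 1 by norm_num,
    Real.Gamma_nat_eq_factorial] at h
  simp_rw [mul_assoc, integral_const_mul]
  rw [← setIntegral_congr_fun (f := fun t : ℝ => t ^ ((2 : ℕ) : ℝ) * Real.exp (-(r * t)))
    measurableSet_Ioi (fun x _ => by simp only [Real.rpow_natCast]; ring), h,
    show ((2 : ℕ) : ℝ) + 1 = (3 : ℕ) by norm_num, Real.rpow_natCast]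
  field_simp
  simp

lemma memLp_id_expMeasure {r : ℝ} (hr : 0 < r) : MemLp (fun x : ℝ => x) 2 (expMeasure r) := by
  refine (memLp_two_iff_integrable_sq (by fun_prop)).2 ?_
  -- A nonintegrable function would have integral `0`, but the second moment is computed to be
  -- positive.
  refine Integrable.of_integral_ne_zero ?_
  rw [integral_sq_expMeasure hr]
  positivity

lemma expMeasure_Iic {r : ℝ} (hr : 0 < r) {s : ℝ} (hs : 0 ≤ s) :
    (expMeasure r).real (Set.Iic s) = 1 - Real.exp (-(r * s)) := by
  have := isProbabilityMeasure_expMeasure hr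
  rw [← cdf_eq_real, cdf_expMeasure_eq hr, if_pos hs]

lemma expMeasure_ae_pos {r : ℝ} (hr : 0 < r) : ∀ᵐ x ∂(expMeasure r), 0 < x := by
  have := isProbabilityMeasure_expMeasure hr
  have h := expMeasure_Iic hr le_rfl
  rw [mul_zero, neg_zero, Real.exp_zero, sub_self, measureReal_eq_zero_iff] at h
  rw [ae_iff]
  convert! h using 2
  ext x; simp

lemma integral_min_expMeasure {r : ℝ} (hr : 0 < r) {s : ℝ} (hs : 0 ≤ s) :
    ∫ x, min s x ∂(expMeasure r) = (1 - Real.exp (-(r * s))) / r := by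
  rw [integral_expMeasure hr]
  have hint1 : IntegrableOn (fun x => r * Real.exp (-(r * x)) * min s x) (Set.Ioc 0 s) :=
    (Continuous.integrableOn_Icc (by fun_prop)).mono_set Set.Ioc_subset_Icc_self
  have hexp : IntegrableOn (fun x => Real.exp (-r * x)) (Set.Ioi s) :=
    exp_neg_integrableOn_Ioi s hr
  have hint2 : IntegrableOn (fun x => r * Real.exp (-(r * x)) * min s x) (Set.Ioi s) := by
    refine (integrableOn_congr_fun (fun x hx => ?_) measurableSet_Ioi).1 (hexp.const_mul (r * s))
    simp only [min_eq_left (le_of_lt (Set.mem_Ioi.1 hx)), neg_mul]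
    ring
  rw [← Set.Ioc_union_Ioi_eq_Ioi hs, setIntegral_union
    (Set.Ioc_disjoint_Ioi le_rfl) measurableSet_Ioi hint1 hint2]
  have e2 : ∫ x in Set.Ioi s, r * Real.exp (-(r * x)) * min s x = s * Real.exp (-(r * s)) := by
    rw [setIntegral_congr_fun (g := fun x => (r * s) * Real.exp (-r * x)) measurableSet_Ioi
      (fun x hx => by
        simp only [min_eq_left (le_of_lt (Set.mem_Ioi.1 hx)), neg_mul]; ring),
      integral_const_mul, integral_exp_mul_Ioi (by linarith)]
    field_simp
  have e1 : ∫ x in Set.Ioc 0 s, r * Real.exp (-(r * x)) * min s x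
      = 1 / r - (s + 1 / r) * Real.exp (-(r * s)) := by
    rw [setIntegral_congr_fun (g := fun x => r * Real.exp (-(r * x)) * x) measurableSet_Ioc
      (fun x hx => by simp only [min_eq_right hx.2]),
      ← intervalIntegral.integral_of_le hs,
      intervalIntegral.integral_eq_sub_of_hasDerivAt
        (f := fun x => -((x + 1 / r) * Real.exp (-(r * x)))) _
        (Continuous.intervalIntegrable (by fun_prop) _ _)]
    · simp; ring
    · intro x _
      have h := (((hasDerivAt_id x).add_const (1 / r)).mul
        (((hasDerivAt_id x).const_mul r).neg.exp)).neg
      refine h.congr_deriv ?_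
      simp only [id, Pi.neg_apply]
      field_simp
      ring
  rw [e1, e2]
  field_simp
  ring

variable {Ω : Type*} {mΩ : MeasurableSpace Ω} {P : Measure Ω}

/-- The probability of an arrival during the service is determined by the Laplace transform of the
service time. -/
lemma integral_arrival_in_service [IsProbabilityMeasure P] {r : ℝ} (hr : 0 < r) {S X : Ω → ℝ} (hS : Measurable S)
    (hX : Measurable X) (hlaw : P.map X = expMeasure r) (hSX : IndepFun S X P)
    (hS0 : ∀ ω, 0 ≤ S ω) :
    ∫ ω, (if S ω < X ω then (0 : ℝ) else 1) ∂P = 1 - ∫ ω, Real.exp (-(r * S ω)) ∂P := by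
  have hpr := isProbabilityMeasure_expMeasure hr
  have hprS : IsProbabilityMeasure (P.map S) := Measure.isProbabilityMeasure_map hS.aemeasurable
  have hprod : P.map (fun ω => (S ω, X ω)) = (P.map S).prod (expMeasure r) := by
    rw [← hlaw]
    exact (indepFun_iff_map_prod_eq_prod_map_map hS.aemeasurable hX.aemeasurable).1 hSX
  have hset : MeasurableSet {z : ℝ × ℝ | z.1 < z.2} := measurableSet_lt measurable_fst measurable_snd
  have hfm : Measurable fun z : ℝ × ℝ => if z.1 < z.2 then (0 : ℝ) else 1 :=
    Measurable.ite hset measurable_const measurable_const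
  have h1 : ∫ ω, (if S ω < X ω then (0 : ℝ) else 1) ∂P
      = ∫ z, (if z.1 < z.2 then (0 : ℝ) else 1) ∂((P.map S).prod (expMeasure r)) := by
    rw [← hprod, integral_map (hS.prodMk hX).aemeasurable hfm.aestronglyMeasurable]
  rw [h1, integral_prod _ (Integrable.of_bound (C := 1) hfm.aestronglyMeasurable
    (Eventually.of_forall fun z => by split_ifs <;> simp))]
  have hae : ∀ᵐ s ∂(P.map S), 0 ≤ s :=
    (ae_map_iff hS.aemeasurable measurableSet_Ici).2 (Eventually.of_forall hS0)
  have h2 : ∀ᵐ s ∂(P.map S), ∫ x, (if s < x then (0 : ℝ) else 1) ∂(expMeasure r)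
      = 1 - Real.exp (-(r * s)) := by
    filter_upwards [hae] with s hs
    rw [← expMeasure_Iic hr hs, ← integral_indicator_one measurableSet_Iic]
    congr 1
    ext x
    by_cases h : s < x
    · simp [h]
    · simp [h, not_lt.1 h]
  have hexpm : Measurable fun s : ℝ => Real.exp (-(r * s)) := by fun_prop
  rw [integral_congr_ae h2, integral_map hS.aemeasurable (by fun_prop), integral_sub
    (integrable_const _), integral_const, probReal_univ, one_smul]
  refine Integrable.of_bound (C := 1) (hexpm.comp hS).aestronglyMeasurable
    (Eventually.of_forall fun ω => ?_)
  rw [Real.norm_of_nonneg (Real.exp_pos _).le, Real.exp_le_one_iff]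
  have := mul_nonneg hr.le (hS0 ω)
  linarith

lemma abs_min_le {s x : ℝ} (hs : 0 ≤ s) : |min s x| ≤ |x| := by
  rcases le_total s x with h | h
  · rw [min_eq_left h, abs_of_nonneg hs]; exact h.trans (le_abs_self x)
  · rw [min_eq_right h]

lemma memLp_of_law {r : ℝ} (hr : 0 < r) {X : Ω → ℝ}
    (hX : Measurable X) (hlaw : P.map X = expMeasure r) : MemLp X 2 P := by
  have h := memLp_id_expMeasure hr
  rw [← hlaw, memLp_map_measure_iff (by fun_prop) hX.aemeasurable] at h
  exact h

lemma memLp_min_of_law {r : ℝ} (hr : 0 < r) {S X : Ω → ℝ} (hS : Measurable S)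
    (hX : Measurable X) (hlaw : P.map X = expMeasure r) (hS0 : ∀ ω, 0 ≤ S ω) :
    MemLp (fun ω => min (S ω) (X ω)) 2 P :=
  (memLp_of_law hr hX hlaw).mono (hS.min hX).aestronglyMeasurable
    (Eventually.of_forall fun ω => abs_min_le (hS0 ω))

/-- By Fubini, averaging the exponential variable first leaves `(1 - exp (-(r s))) / r`, so only the
Laplace transform of `S` at `r` enters. -/
lemma integral_min_of_law [IsProbabilityMeasure P] {r : ℝ} (hr : 0 < r) {S X : Ω → ℝ} (hS : Measurable S)
    (hX : Measurable X) (hlaw : P.map X = expMeasure r) (hSX : IndepFun S X P)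
    (hS0 : ∀ ω, 0 ≤ S ω) :
    ∫ ω, min (S ω) (X ω) ∂P = (1 - ∫ ω, Real.exp (-(r * S ω)) ∂P) / r := by
  have hpr := isProbabilityMeasure_expMeasure hr
  have hprS : IsProbabilityMeasure (P.map S) := Measure.isProbabilityMeasure_map hS.aemeasurable
  have hprod : P.map (fun ω => (S ω, X ω)) = (P.map S).prod (expMeasure r) := by
    rw [← hlaw]
    exact (indepFun_iff_map_prod_eq_prod_map_map hS.aemeasurable hX.aemeasurable).1 hSX
  have hfm : Measurable fun z : ℝ × ℝ => min z.1 z.2 := by fun_prop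
  have hint : Integrable (fun z : ℝ × ℝ => min z.1 z.2) ((P.map S).prod (expMeasure r)) := by
    rw [← hprod, integrable_map_measure hfm.aestronglyMeasurable (hS.prodMk hX).aemeasurable]
    exact (memLp_min_of_law hr hS hX hlaw hS0).integrable one_le_two
  have h1 : ∫ ω, min (S ω) (X ω) ∂P = ∫ z, min z.1 z.2 ∂((P.map S).prod (expMeasure r)) := by
    rw [← hprod, integral_map (hS.prodMk hX).aemeasurable hfm.aestronglyMeasurable]
  rw [h1, integral_prod _ hint]
  have hae : ∀ᵐ s ∂(P.map S), 0 ≤ s :=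
    (ae_map_iff hS.aemeasurable measurableSet_Ici).2 (Eventually.of_forall hS0)
  have h2 : ∀ᵐ s ∂(P.map S), ∫ x, min s x ∂(expMeasure r) = (1 - Real.exp (-(r * s))) / r := by
    filter_upwards [hae] with s hs
    exact integral_min_expMeasure hr hs
  have hexpm : Measurable fun s : ℝ => Real.exp (-(r * s)) := by fun_prop
  rw [integral_congr_ae h2, integral_map hS.aemeasurable (by fun_prop), integral_div, integral_sub
    (integrable_const _), integral_const, probReal_univ, one_smul]
  refine Integrable.of_bound (C := 1) (hexpm.comp hS).aestronglyMeasurable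
    (Eventually.of_forall fun ω => ?_)
  rw [Real.norm_of_nonneg (Real.exp_pos _).le, Real.exp_le_one_iff]
  have := mul_nonneg hr.le (hS0 ω)
  linarith

end Exponential

/-! ### Second-moment law of large numbers along the squares -/

section Orthogonal

variable {Ω : Type*} {mΩ : MeasurableSpace Ω} {P : Measure Ω}

/-- Sums of products of a predictable factor with an independent centred factor have linearly
growing second moments. -/
lemma integral_sq_sum_mul_le [IsProbabilityMeasure P] {H : ℕ → MeasurableSpace Ω} (hmono : Monotone H) (hle : ∀ j, H j ≤ mΩ)
    {A W : ℕ → Ω → ℝ} (hA : ∀ j, Measurable[H j] (A j)) (hW : ∀ j, Measurable[H (j + 1)] (W j))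
    (hind : ∀ j, Indep (H j) (MeasurableSpace.comap (W j) inferInstance) P)
    (hA2 : ∀ j, MemLp (A j) 2 P) (hW2 : ∀ j, MemLp (W j) 2 P) (hW0 : ∀ j, ∫ ω, W j ω ∂P = 0)
    {K V : ℝ} (hK : ∀ j, ∫ ω, A j ω ^ 2 ∂P ≤ K) (hV : ∀ j, ∫ ω, W j ω ^ 2 ∂P ≤ V) (N : ℕ) :
    Measurable[H N] (fun ω => ∑ j ∈ Finset.range N, A j ω * W j ω) ∧
    MemLp (fun ω => ∑ j ∈ Finset.range N, A j ω * W j ω) 2 P ∧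
    ∫ ω, (∑ j ∈ Finset.range N, A j ω * W j ω) ^ 2 ∂P ≤ N * (K * V) := by
  induction N with
  | zero => simp [measurable_const]
  | succ N ih =>
    obtain ⟨ihm, ih2, ihb⟩ := ih
    set Y : Ω → ℝ := fun ω => ∑ j ∈ Finset.range N, A j ω * W j ω with hY
    have hindep : ∀ f : Ω → ℝ, Measurable[H N] f → IndepFun f (W N) P := fun f hf =>
      indep_of_indep_of_le_left (hind N) hf.comap_le
    have hAm := (hA N).mono (hle N) le_rfl
    have hWm := (hW N).mono (hle (N + 1)) le_rfl
    have hsqA : Integrable (fun ω => A N ω ^ 2) P := (hA2 N).integrable_sq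
    have hsqW : Integrable (fun ω => W N ω ^ 2) P := (hW2 N).integrable_sq
    have hindsq : IndepFun (fun ω => A N ω ^ 2) (fun ω => W N ω ^ 2) P :=
      (hindep _ (hA N)).comp (φ := fun x : ℝ => x ^ 2) (ψ := fun x : ℝ => x ^ 2)
        (by fun_prop) (by fun_prop)
    have hintsq : Integrable (fun ω => A N ω ^ 2 * W N ω ^ 2) P := hindsq.integrable_mul hsqA hsqW
    have hmulsq : ∫ ω, A N ω ^ 2 * W N ω ^ 2 ∂P ≤ K * V := by
      rw [hindsq.integral_fun_mul_eq_mul_integral hsqA.1 hsqW.1]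
      exact mul_le_mul (hK N) (hV N) (integral_nonneg fun ω => sq_nonneg _)
        ((integral_nonneg fun ω => sq_nonneg _).trans (hK N))
    have hAW2 : MemLp (fun ω => A N ω * W N ω) 2 P := by
      refine (memLp_two_iff_integrable_sq (hAm.mul hWm).aestronglyMeasurable).2 ?_
      refine hintsq.congr (Eventually.of_forall fun ω => ?_)
      simp only [Pi.mul_apply, mul_pow]
    have hYA : Integrable (fun ω => Y ω * A N ω) P := ih2.integrable_mul (hA2 N)
    have hindc : IndepFun (fun ω => Y ω * A N ω) (W N) P := hindep _ (ihm.mul (hA N))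
    have hW1 : Integrable (W N) P := (hW2 N).integrable one_le_two
    -- Orthogonality: `Y * A N` is known at stage `N`, and `W N` is centred and independent of that
    -- stage.
    have hcross : ∫ ω, Y ω * A N ω * W N ω ∂P = 0 := by
      rw [hindc.integral_fun_mul_eq_mul_integral hYA.1 hW1.1, hW0, mul_zero]
    have hcrossi : Integrable (fun ω => Y ω * A N ω * W N ω) P := hindc.integrable_mul hYA hW1
    have hfun : (fun ω => ∑ j ∈ Finset.range (N + 1), A j ω * W j ω)
        = fun ω => Y ω + A N ω * W N ω := by
      ext ω; rw [Finset.sum_range_succ]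
    refine ⟨?_, ?_, ?_⟩
    · rw [hfun]
      exact (ihm.mono (hmono N.le_succ) le_rfl).add (((hA N).mono (hmono N.le_succ) le_rfl).mul (hW N))
    · rw [hfun]; exact ih2.add hAW2
    · have he : ∀ ω, (∑ j ∈ Finset.range (N + 1), A j ω * W j ω) ^ 2
          = Y ω ^ 2 + 2 * (Y ω * A N ω * W N ω) + A N ω ^ 2 * W N ω ^ 2 := by
        intro ω; rw [Finset.sum_range_succ]; simp only [hY]; ring
      simp only [he]
      have hi : Integrable (fun ω => Y ω ^ 2 + 2 * (Y ω * A N ω * W N ω)) P :=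
        ih2.integrable_sq.add (hcrossi.const_mul 2)
      rw [integral_add hi hintsq, integral_add ih2.integrable_sq (hcrossi.const_mul 2), integral_const_mul, hcross]
      push_cast
      linarith

/-- A sequence with linearly growing second moments is negligible along the squares. -/
lemma ae_tendsto_div_of_integral_sq_le {Y : ℕ → Ω → ℝ} (hY : ∀ n, MemLp (Y n) 2 P) {C : ℝ}
    (hC : ∀ n, ∫ ω, Y n ω ^ 2 ∂P ≤ C * (n + 1)) :
    ∀ᵐ ω ∂P, Tendsto (fun j : ℕ => Y ((j + 1) ^ 2) ω / ((j + 1) ^ 2 : ℕ)) atTop (𝓝 0) := by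
  set f : ℕ → Ω → ℝ := fun j ω => (Y ((j + 1) ^ 2) ω / ((j + 1) ^ 2 : ℕ)) ^ 2 with hf
  have hC0 : 0 ≤ C := by
    have h := (integral_nonneg fun ω => sq_nonneg (Y 0 ω)).trans (hC 0)
    simpa using h
  have hfi : ∀ j, Integrable (f j) P := fun j => by
    simp only [hf, div_pow]
    exact (hY _).integrable_sq.div_const _
  -- For `N = (j + 1) ^ 2` the bound is `C (N + 1) / N ^ 2 ≤ 2 C / N`, which is summable over `j`;
  -- so the sum of the `f j` is almost surely finite and its terms tend to `0`.
  have hfb : ∀ j, ∫ ω, f j ω ∂P ≤ 2 * C * (1 / ((j + 1 : ℕ) : ℝ) ^ 2) := by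
    intro j
    simp only [hf, div_pow]
    rw [integral_div, div_le_iff₀ (by positivity)]
    refine (hC _).trans ?_
    have h1 : (1 : ℝ) ≤ ((j + 1 : ℕ) : ℝ) ^ 2 := by
      have : (1 : ℝ) ≤ ((j + 1 : ℕ) : ℝ) := by push_cast; linarith [(Nat.cast_nonneg j : (0 : ℝ) ≤ j)]
      nlinarith
    rw [Nat.cast_pow]
    set t : ℝ := ((j + 1 : ℕ) : ℝ) ^ 2 with ht
    have : 2 * C * (1 / t) * t ^ 2 = 2 * C * t := by field_simp
    rw [this]
    nlinarith
  have hsum : Summable fun j => ∫ ω, f j ω ∂P := by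
    refine Summable.of_nonneg_of_le (fun j => integral_nonneg fun ω => sq_nonneg _) hfb ?_
    refine Summable.mul_left _ ?_
    exact (summable_nat_add_iff 1).2 (Real.summable_one_div_nat_pow.2 one_lt_two)
  have hlin : ∫⁻ ω, ∑' j, ENNReal.ofReal (f j ω) ∂P ≠ ⊤ := by
    rw [lintegral_tsum fun j => (hfi j).1.aemeasurable.ennreal_ofReal]
    have : ∀ j, ∫⁻ ω, ENNReal.ofReal (f j ω) ∂P = ENNReal.ofReal (∫ ω, f j ω ∂P) := fun j =>
      (ofReal_integral_eq_lintegral_ofReal (hfi j) (Eventually.of_forall fun ω => sq_nonneg _)).symm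
    simp only [this]
    exact hsum.tsum_ofReal_ne_top
  filter_upwards [ae_lt_top' (AEMeasurable.tsum fun j =>
    (hfi j).1.aemeasurable.ennreal_ofReal) hlin] with ω hω
  have h1 := ENNReal.tendsto_atTop_zero_of_tsum_ne_top hω.ne
  have h2 : Tendsto (fun j => f j ω) atTop (𝓝 0) := by
    have h3 := (ENNReal.tendsto_toReal ENNReal.zero_ne_top).comp h1
    rw [ENNReal.toReal_zero] at h3
    refine h3.congr fun j => ?_
    exact ENNReal.toReal_ofReal (sq_nonneg _)
  have h4 := h2.sqrt
  rw [Real.sqrt_zero] at h4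
  simp only [hf, Real.sqrt_sq_eq_abs] at h4
  exact (tendsto_zero_iff_abs_tendsto_zero _).2 h4

/-- Convergence of averages along the squares suffices for monotone sums. -/
lemma tendsto_div_of_monotone_of_tendsto_sq {u : ℕ → ℝ} (hu : Monotone u) {l : ℝ}
    (h : Tendsto (fun j : ℕ => u ((j + 1) ^ 2) / ((j + 1) ^ 2 : ℕ)) atTop (𝓝 l)) :
    Tendsto (fun n : ℕ => u n / n) atTop (𝓝 l) := by
  refine tendsto_div_of_monotone_of_exists_subseq_tendsto_div u l hu fun a ha => ?_
  refine ⟨fun j => (j + 1) ^ 2, ?_, ?_, h⟩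
  · have h1 : Tendsto (fun j : ℕ => (1 + ((j : ℝ) + 1)⁻¹) ^ 2) atTop (𝓝 ((1 + 0) ^ 2)) := by
      refine (tendsto_const_nhds.add ?_).pow 2
      simpa using tendsto_one_div_add_atTop_nhds_zero_nat (𝕜 := ℝ)
    rw [add_zero, one_pow] at h1
    filter_upwards [(tendsto_order.1 h1).2 a ha] with j hj
    have hj0 : (0 : ℝ) < (j : ℝ) + 1 := by positivity
    push_cast
    have : ((j : ℝ) + 1 + 1) ^ 2 = (1 + ((j : ℝ) + 1)⁻¹) ^ 2 * ((j : ℝ) + 1) ^ 2 := by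
      field_simp
    rw [this]
    gcongr
  · exact (tendsto_pow_atTop two_ne_zero).comp (tendsto_add_atTop_nat 1)

end Orthogonal

/-! ### The age recursion and the long-run average -/

section Reward

lemma measurable_ageBefore_step {Ω : Type*} [MeasurableSpace Ω] {S X A : Ω → ℝ} (hS : Measurable S)
    (hX : Measurable X) (hA : Measurable A) :
    Measurable fun ω => X ω + if S ω < X ω then 0 else A ω :=
  hX.add (Measurable.ite (measurableSet_lt hS hX) measurable_const hA)

/-- Indicator of the event that the service is interrupted by the next arrival. -/
def preempted (s x : ℝ) : ℝ := if s < x then 0 else 1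

lemma measurable_preempted : Measurable fun z : ℝ × ℝ => preempted z.1 z.2 :=
  Measurable.ite (measurableSet_lt measurable_fst measurable_snd) measurable_const measurable_const

lemma preempted_nonneg (s x : ℝ) : 0 ≤ preempted s x := by unfold preempted; split_ifs <;> simp

lemma preempted_le_one (s x : ℝ) : preempted s x ≤ 1 := by unfold preempted; split_ifs <;> simp

lemma preempted_sq (s x : ℝ) : preempted s x ^ 2 = preempted s x := by
  unfold preempted; split_ifs <;> simp

lemma ageBefore_succ (x s : ℕ → ℝ) (a₀ : ℝ) (i : ℕ) :
    ageBefore x s a₀ (i + 1) = x (i + 1) + preempted (s i) (x (i + 1)) * ageBefore x s a₀ i := by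
  rw [ageBefore, preempted]; split_ifs <;> simp

variable {Ω : Type*} {mΩ : MeasurableSpace Ω} {P : Measure Ω}

/-- A sequence of independent interarrival and service times adapted to a filtration `H`, where
`r` is the arrival rate and `p` is the Laplace transform of the service times at `r`, that is, the
probability of a successful reception. -/
structure IsRenewal (P : Measure Ω) (r p : ℝ) (X S : ℕ → Ω → ℝ) (H : ℕ → MeasurableSpace Ω) :
    Prop where
  rate_pos : 0 < r
  p_pos : 0 < p
  mono : Monotone H
  le : ∀ i, H i ≤ mΩ
  measurable_X : ∀ i, Measurable[H i] (X i)
  measurable_S : ∀ i, Measurable[H (i + 1)] (S i)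
  indep : ∀ i, Indep (H i) (MeasurableSpace.comap (fun ω => (S i ω, X (i + 1) ω)) inferInstance) P
  indep_S_X : ∀ i, IndepFun (S i) (X (i + 1)) P
  indep_X : iIndepFun X P
  law_X : ∀ i, P.map (X i) = expMeasure r
  S_nonneg : ∀ i ω, 0 ≤ S i ω
  laplace_S : ∀ i, ∫ ω, Real.exp (-(r * S i ω)) ∂P = p

namespace IsRenewal

variable {r p : ℝ} {X S : ℕ → Ω → ℝ} {H : ℕ → MeasurableSpace Ω} (h : IsRenewal P r p X S H)
include h

lemma meas_X (i : ℕ) : Measurable (X i) := (h.measurable_X i).mono (h.le i) le_rfl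

lemma meas_S (i : ℕ) : Measurable (S i) := (h.measurable_S i).mono (h.le (i + 1)) le_rfl

lemma indepFun_of_measurable {f : Ω → ℝ} {i : ℕ} (hf : Measurable[H i] f) {g : ℝ × ℝ → ℝ}
    (hg : Measurable g) : IndepFun f (fun ω => g (S i ω, X (i + 1) ω)) P := by
  refine indep_of_indep_of_le_left (indep_of_indep_of_le_right (h.indep i) ?_) hf.comap_le
  exact (hg.comp (comap_measurable fun ω => (S i ω, X (i + 1) ω))).comap_le

lemma measurable_preempted (i : ℕ) : Measurable fun ω => preempted (S i ω) (X (i + 1) ω) :=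
  FRHARQ.measurable_preempted.comp ((h.meas_S i).prodMk (h.meas_X (i + 1)))

lemma measurable_ageBefore (a₀ : ℝ) (i : ℕ) :
    Measurable[H i] fun ω => ageBefore (fun i => X i ω) (fun i => S i ω) a₀ i := by
  induction i with
  | zero => exact (h.measurable_X 0).const_add a₀
  | succ i ih =>
    exact @measurable_ageBefore_step Ω (H (i + 1)) _ _ _ (h.measurable_S i) (h.measurable_X (i + 1))
      (ih.mono (h.mono i.le_succ) le_rfl)

lemma memLp_X (i : ℕ) : MemLp (X i) 2 P := memLp_of_law h.rate_pos (h.meas_X i) (h.law_X i)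

lemma integral_X (i : ℕ) : ∫ ω, X i ω ∂P = 1 / r := by
  rw [← integral_id_expMeasure h.rate_pos, ← h.law_X i,
    integral_map (h.meas_X i).aemeasurable (by fun_prop)]

lemma integral_X_sq (i : ℕ) : ∫ ω, X i ω ^ 2 ∂P = 2 / r ^ 2 := by
  rw [← integral_sq_expMeasure h.rate_pos, ← h.law_X i,
    integral_map (h.meas_X i).aemeasurable (by fun_prop)]

lemma ae_X_pos : ∀ᵐ ω ∂P, ∀ i, 0 < X i ω := by
  refine ae_all_iff.2 fun i => ?_
  have := expMeasure_ae_pos h.rate_pos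
  rw [← h.law_X i] at this
  exact (ae_map_iff (h.meas_X i).aemeasurable measurableSet_Ioi).1 this

lemma ae_tendsto_sum_X_sq :
    ∀ᵐ ω ∂P, Tendsto (fun n : ℕ => (∑ i ∈ Finset.range n, X (i + 1) ω ^ 2) / n) atTop
      (𝓝 (2 / r ^ 2)) := by
  rw [← h.integral_X_sq 1]
  have hsq : Measurable fun x : ℝ => x ^ 2 := by fun_prop
  refine strong_law_ae_real (fun i ω => X (i + 1) ω ^ 2) (h.memLp_X 1).integrable_sq ?_ ?_
  · exact fun i j hij => (h.indep_X.indepFun (by simpa using hij)).comp hsq hsq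
  · intro i
    have : IdentDistrib (X (i + 1)) (X (0 + 1)) P P :=
      ⟨(h.meas_X _).aemeasurable, (h.meas_X _).aemeasurable, by simp [h.law_X]⟩
    exact this.comp hsq

variable [IsProbabilityMeasure P]

lemma p_le_one : p ≤ 1 := by
  rw [← h.laplace_S 0]
  have hb : ∀ ω, Real.exp (-(r * S 0 ω)) ≤ 1 := fun ω => by
    rw [Real.exp_le_one_iff]
    have := mul_nonneg h.rate_pos.le (h.S_nonneg 0 ω)
    linarith
  have hm : Measurable fun s : ℝ => Real.exp (-(r * s)) := by fun_prop
  calc ∫ ω, Real.exp (-(r * S 0 ω)) ∂P ≤ ∫ _, (1 : ℝ) ∂P :=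
        integral_mono (Integrable.of_bound (C := 1) (hm.comp (h.meas_S 0)).aestronglyMeasurable
          (Eventually.of_forall fun ω => by
            rw [Real.norm_of_nonneg (Real.exp_pos _).le]; exact hb ω)) (integrable_const _) hb
    _ = 1 := by simp

lemma integral_preempted (i : ℕ) : ∫ ω, preempted (S i ω) (X (i + 1) ω) ∂P = 1 - p := by
  rw [← h.laplace_S i]
  exact integral_arrival_in_service h.rate_pos (h.meas_S i) (h.meas_X _) (h.law_X _)
    (h.indep_S_X i) (h.S_nonneg i)

lemma memLp_ageBefore (a₀ : ℝ) (i : ℕ) :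
    MemLp (fun ω => ageBefore (fun i => X i ω) (fun i => S i ω) a₀ i) 2 P := by
  induction i with
  | zero => exact (memLp_const a₀).add (h.memLp_X 0)
  | succ i ih =>
    simp only [ageBefore_succ]
    refine (h.memLp_X (i + 1)).add (ih.mono ?_ (Eventually.of_forall fun ω => ?_))
    · exact ((h.measurable_preempted i).mul
        ((h.measurable_ageBefore a₀ i).mono (h.le i) le_rfl)).aestronglyMeasurable
    · rw [norm_mul, Real.norm_of_nonneg (preempted_nonneg _ _)]
      exact mul_le_of_le_one_left (norm_nonneg _) (preempted_le_one _ _)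

/-- Preemption contracts the second moment: independence of `A i` and `F i` turns the recursion into
`a (i + 1) ≤ B + ρ a i` with `ρ = 2 (1 - p) / (2 - p) < 1`. -/
lemma exists_integral_ageBefore_sq_le (a₀ : ℝ) : ∃ K, ∀ i,
    ∫ ω, ageBefore (fun i => X i ω) (fun i => S i ω) a₀ i ^ 2 ∂P ≤ K := by
  set A : ℕ → Ω → ℝ := fun i ω => ageBefore (fun i => X i ω) (fun i => S i ω) a₀ i with hA
  set F : ℕ → Ω → ℝ := fun i ω => preempted (S i ω) (X (i + 1) ω) with hF
  have hp := h.p_pos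
  have hp1 := h.p_le_one
  have hstep : ∀ i, ∫ ω, A (i + 1) ω ^ 2 ∂P
      ≤ (2 / p) * (2 / r ^ 2) + (2 / (2 - p) * (1 - p)) * ∫ ω, A i ω ^ 2 ∂P := by
    intro i
    have hAi : Integrable (fun ω => A i ω ^ 2) P := (h.memLp_ageBefore a₀ i).integrable_sq
    have hAm : Measurable[H i] fun ω => A i ω ^ 2 := (h.measurable_ageBefore a₀ i).pow_const 2
    have hind : IndepFun (fun ω => A i ω ^ 2) (F i) P :=
      h.indepFun_of_measurable hAm FRHARQ.measurable_preempted
    have hFi : Integrable (F i) P := Integrable.of_bound (C := 1)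
      (h.measurable_preempted i).aestronglyMeasurable (Eventually.of_forall fun ω => by
        rw [Real.norm_of_nonneg (preempted_nonneg _ _)]; exact preempted_le_one _ _)
    have hFA : Integrable (fun ω => A i ω ^ 2 * F i ω) P := hind.integrable_mul hAi hFi
    have hX2 : Integrable (fun ω => X (i + 1) ω ^ 2) P := (h.memLp_X (i + 1)).integrable_sq
    -- Cauchy–Schwarz with weights `p / 2` and `(2 - p) / 2`, chosen to keep `ρ < 1`; moreover `F ^
    -- 2 = F`.
    have hle : ∀ ω, A (i + 1) ω ^ 2
        ≤ 2 / p * X (i + 1) ω ^ 2 + 2 / (2 - p) * (A i ω ^ 2 * F i ω) := by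
      intro ω
      have e : A (i + 1) ω = X (i + 1) ω + F i ω * A i ω := ageBefore_succ _ _ _ _
      have hsq : F i ω ^ 2 = F i ω := preempted_sq _ _
      have e2 : A i ω ^ 2 * F i ω = (F i ω * A i ω) ^ 2 := by rw [mul_pow, hsq]; ring
      rw [e, e2]
      set x := X (i + 1) ω
      set y := F i ω * A i ω
      have h2p : 0 < 2 - p := by linarith
      have e3 : 2 / p * x ^ 2 + 2 / (2 - p) * y ^ 2 - (x + y) ^ 2
          = ((2 - p) * x - p * y) ^ 2 / (p * (2 - p)) := by
        field_simp
        ring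
      have : 0 ≤ ((2 - p) * x - p * y) ^ 2 / (p * (2 - p)) := by positivity
      linarith
    calc ∫ ω, A (i + 1) ω ^ 2 ∂P
        ≤ ∫ ω, (2 / p * X (i + 1) ω ^ 2 + 2 / (2 - p) * (A i ω ^ 2 * F i ω)) ∂P :=
          integral_mono (h.memLp_ageBefore a₀ (i + 1)).integrable_sq
            ((hX2.const_mul _).add (hFA.const_mul _)) hle
      _ = _ := by
        rw [integral_add (hX2.const_mul _) (hFA.const_mul _), integral_const_mul,
          integral_const_mul, h.integral_X_sq, hind.integral_fun_mul_eq_mul_integral hAi.1 hFi.1,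
          show ∫ ω, F i ω ∂P = 1 - p from h.integral_preempted i]
        ring
  set B : ℝ := (2 / p) * (2 / r ^ 2) with hB
  set ρ : ℝ := 2 / (2 - p) * (1 - p) with hρ
  have h2p : 0 < 2 - p := by linarith
  have hρ1 : ρ < 1 := by
    rw [hρ, div_mul_eq_mul_div, div_lt_one h2p]; linarith
  have hρ0 : 0 ≤ ρ := mul_nonneg (by positivity) (by linarith)
  refine ⟨max (∫ ω, A 0 ω ^ 2 ∂P) (B / (1 - ρ)), fun i => ?_⟩
  induction i with
  | zero => exact le_max_left _ _
  | succ i ih =>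
    refine (hstep i).trans ?_
    set K := max (∫ ω, A 0 ω ^ 2 ∂P) (B / (1 - ρ)) with hK
    have h1 : B / (1 - ρ) ≤ K := le_max_right _ _
    rw [div_le_iff₀ (by linarith)] at h1
    have h2 : ρ * ∫ ω, A i ω ^ 2 ∂P ≤ ρ * K := mul_le_mul_of_nonneg_left ih hρ0
    linarith

lemma ae_tendsto_sum_X :
    ∀ᵐ ω ∂P, Tendsto (fun n : ℕ => (∑ i ∈ Finset.range n, X (i + 1) ω) / n) atTop (𝓝 (1 / r)) := by
  rw [← h.integral_X 1]
  refine strong_law_ae_real (fun i => X (i + 1)) ((h.memLp_X 1).integrable one_le_two) ?_ ?_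
  · exact fun i j hij => h.indep_X.indepFun (by simpa using hij)
  · exact fun i => ⟨(h.meas_X _).aemeasurable, (h.meas_X _).aemeasurable, by simp [h.law_X]⟩

/-- The average of the area contributed by the age at the beginning of the service. -/
lemma ae_tendsto_sum_ageBefore_mul (a₀ : ℝ) :
    ∀ᵐ ω ∂P, Tendsto (fun j : ℕ => (∑ i ∈ Finset.range ((j + 1) ^ 2),
        ageBefore (fun i => X i ω) (fun i => S i ω) a₀ i
          * timeInService (fun i => X i ω) (fun i => S i ω) i) / (((j + 1) ^ 2 : ℕ) : ℝ)) atTop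
      (𝓝 ((1 - p) / (r ^ 2 * p))) := by
  have hr := h.rate_pos
  have hp := h.p_pos
  have hp1 := h.p_le_one
  set A : ℕ → Ω → ℝ := fun i ω => ageBefore (fun i => X i ω) (fun i => S i ω) a₀ i with hA
  -- The solution of `b + c * (1 - p) = c`, where `b` is the mean time in service: with it the mean
  -- part of `A i * T i + c * F i * A i` is exactly `c * A i`, which telescopes.
  set c : ℝ := (1 - p) / (r * p) with hc
  have hc0 : 0 ≤ c := div_nonneg (by linarith) (by positivity)
  set b : ℝ := (1 - p) / r with hb
  have hb0 : 0 ≤ b := div_nonneg (by linarith) hr.le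
  have hbc : b = c * p := by rw [hb, hc]; field_simp
  set g : ℝ × ℝ → ℝ := fun z => (min z.1 z.2 - b) + c * (preempted z.1 z.2 - (1 - p)) with hg
  have hgm : Measurable g := ((measurable_fst.min measurable_snd).sub_const b).add
    ((FRHARQ.measurable_preempted.sub_const (1 - p)).const_mul c)
  set W : ℕ → Ω → ℝ := fun i ω => g (S i ω, X (i + 1) ω) with hW
  have hWmeas : ∀ i, Measurable[H (i + 1)] (W i) := fun i =>
    hgm.comp ((h.measurable_S i).prodMk (h.measurable_X (i + 1)))
  have hbound : ∀ i ω, |W i ω| ≤ |X (i + 1) ω| + (b + c) := by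
    intro i ω
    have h1 := abs_min_le (x := X (i + 1) ω) (h.S_nonneg i ω)
    have h2 := preempted_nonneg (S i ω) (X (i + 1) ω)
    have h3 := preempted_le_one (S i ω) (X (i + 1) ω)
    have h4 : |preempted (S i ω) (X (i + 1) ω) - (1 - p)| ≤ 1 := by
      rw [abs_le]; constructor <;> linarith
    calc |W i ω| ≤ |min (S i ω) (X (i + 1) ω) - b|
          + |c * (preempted (S i ω) (X (i + 1) ω) - (1 - p))| := abs_add_le _ _
      _ ≤ (|min (S i ω) (X (i + 1) ω)| + |b|) + c * 1 := by
        rw [abs_mul, abs_of_nonneg hc0]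
        gcongr
        exact abs_sub _ _
      _ ≤ _ := by rw [abs_of_nonneg hb0]; linarith
  have hdom : ∀ i, MemLp (fun ω => |X (i + 1) ω| + (b + c)) 2 P := fun i =>
    (h.memLp_X (i + 1)).abs.add (memLp_const _)
  have hW2 : ∀ i, MemLp (W i) 2 P := fun i =>
    (hdom i).mono ((hWmeas i).mono (h.le _) le_rfl).aestronglyMeasurable
      (Eventually.of_forall fun ω => (hbound i ω).trans (le_abs_self _))
  have hV : ∀ i, ∫ ω, W i ω ^ 2 ∂P ≤ 2 * (2 / r ^ 2) + 2 * (b + c) ^ 2 := by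
    intro i
    have hi : Integrable (fun ω => 2 * X (i + 1) ω ^ 2) P :=
      (h.memLp_X (i + 1)).integrable_sq.const_mul 2
    calc ∫ ω, W i ω ^ 2 ∂P ≤ ∫ ω, (2 * X (i + 1) ω ^ 2 + 2 * (b + c) ^ 2) ∂P := by
          refine integral_mono (hW2 i).integrable_sq (hi.add (integrable_const _)) fun ω => ?_
          simp only
          rw [← sq_abs (W i ω), ← sq_abs (X (i + 1) ω)]
          have h1 := hbound i ω
          have h2 := abs_nonneg (W i ω)
          nlinarith [sq_nonneg (|X (i + 1) ω| - (b + c))]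
      _ = _ := by
        rw [integral_add hi (integrable_const _), integral_const_mul, h.integral_X_sq]
        simp
  have hW0 : ∀ i, ∫ ω, W i ω ∂P = 0 := by
    intro i
    have i1 : Integrable (fun ω => min (S i ω) (X (i + 1) ω)) P :=
      (memLp_min_of_law hr (h.meas_S i) (h.meas_X _) (h.law_X _) (h.S_nonneg i)).integrable
        one_le_two
    have i2 : Integrable (fun ω => preempted (S i ω) (X (i + 1) ω)) P := Integrable.of_bound (C := 1)
      (h.measurable_preempted i).aestronglyMeasurable (Eventually.of_forall fun ω => by
        rw [Real.norm_of_nonneg (preempted_nonneg _ _)]; exact preempted_le_one _ _)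
    simp only [hW, hg]
    have k1 : Integrable (fun ω => min (S i ω) (X (i + 1) ω) - b) P := i1.sub (integrable_const _)
    have k2 : Integrable (fun ω => c * (preempted (S i ω) (X (i + 1) ω) - (1 - p))) P :=
      (i2.sub (integrable_const _)).const_mul c
    rw [integral_add k1 k2,
      integral_const_mul, integral_sub i1 (integrable_const _), integral_sub i2 (integrable_const _),
      h.integral_preempted, integral_min_of_law hr (h.meas_S i) (h.meas_X _) (h.law_X _)
        (h.indep_S_X i) (h.S_nonneg i), h.laplace_S]
    simp [hb]
  obtain ⟨K, hK⟩ := h.exists_integral_ageBefore_sq_le a₀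
  have hA2 := h.memLp_ageBefore a₀
  have horth := integral_sq_sum_mul_le h.mono h.le (h.measurable_ageBefore a₀) hWmeas
    (fun i => indep_of_indep_of_le_right (h.indep i)
      (hgm.comp (comap_measurable fun ω => (S i ω, X (i + 1) ω))).comap_le) hA2 hW2 hW0 hK hV
  set V : ℝ := 2 * (2 / r ^ 2) + 2 * (b + c) ^ 2 with hVdef
  have hK0 : 0 ≤ K := (integral_nonneg fun ω => sq_nonneg _).trans (hK 0)
  have hV0 : 0 ≤ V := by positivity
  -- The boundary term of the telescoping sum is included, so one second-moment bound handles it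
  -- together with the orthogonal sum.
  set Y : ℕ → Ω → ℝ := fun N ω => ∑ i ∈ Finset.range N, A i ω * W i ω - c * A N ω with hY
  have hY2 : ∀ N, MemLp (Y N) 2 P := fun N => (horth N).2.1.sub ((hA2 N).const_mul c)
  have hYb : ∀ N, ∫ ω, Y N ω ^ 2 ∂P ≤ (2 * (K * V) + 2 * c ^ 2 * K) * (N + 1) := by
    intro N
    have j1 : Integrable (fun ω => 2 * (∑ i ∈ Finset.range N, A i ω * W i ω) ^ 2) P :=
      (horth N).2.1.integrable_sq.const_mul 2
    have j2 : Integrable (fun ω => 2 * c ^ 2 * A N ω ^ 2) P := (hA2 N).integrable_sq.const_mul _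
    calc ∫ ω, Y N ω ^ 2 ∂P
        ≤ ∫ ω, (2 * (∑ i ∈ Finset.range N, A i ω * W i ω) ^ 2 + 2 * c ^ 2 * A N ω ^ 2) ∂P := by
          refine integral_mono (hY2 N).integrable_sq (j1.add j2) fun ω => ?_
          simp only [hY]
          nlinarith [sq_nonneg (∑ i ∈ Finset.range N, A i ω * W i ω + c * A N ω)]
      _ ≤ 2 * (N * (K * V)) + 2 * c ^ 2 * K := by
        rw [integral_add j1 j2, integral_const_mul, integral_const_mul]
        gcongr
        · exact (horth N).2.2
        · exact hK N
      _ ≤ _ := by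
        have e1 : 0 ≤ 2 * (K * V) := by positivity
        have e2 : 0 ≤ 2 * c ^ 2 * K * N := by positivity
        nlinarith
  filter_upwards [ae_tendsto_div_of_integral_sq_le hY2 hYb, h.ae_tendsto_sum_X] with ω hω1 hω2
  have hident : ∀ N : ℕ, ∑ i ∈ Finset.range N,
      ageBefore (fun i => X i ω) (fun i => S i ω) a₀ i
          * timeInService (fun i => X i ω) (fun i => S i ω) i
      = Y N ω + c * A 0 ω + c * ∑ i ∈ Finset.range N, X (i + 1) ω := by
    intro N
    induction N with
    | zero => simp [hY]
    | succ N ih =>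
      rw [Finset.sum_range_succ, ih]
      simp only [hY, Finset.sum_range_succ]
      have e : A (N + 1) ω = X (N + 1) ω + preempted (S N ω) (X (N + 1) ω) * A N ω :=
        ageBefore_succ _ _ _ _
      rw [e]
      show _ + A N ω * min (S N ω) (X (N + 1) ω) = _
      simp only [hW, hg, hbc]
      ring
  have hsq : Tendsto (fun j : ℕ => (j + 1) ^ 2) atTop atTop :=
    (tendsto_pow_atTop two_ne_zero).comp (tendsto_add_atTop_nat 1)
  have l1 := (hω2.comp hsq).const_mul c
  have l2 := (tendsto_const_div_atTop_nhds_zero_nat (𝕜 := ℝ) (c * A 0 ω)).comp hsq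
  have l := (hω1.add l2).add l1
  rw [add_zero, zero_add] at l
  have hval : c * (1 / r) = (1 - p) / (r ^ 2 * p) := by rw [hc]; field_simp
  rw [hval] at l
  refine l.congr fun j => ?_
  rw [hident]
  simp only [Function.comp]
  ring

/-- The terms `A i * T i` are nonnegative because `a₀ ≥ 0`, so their partial sums are monotone and
the limit along the squares extends to all `n`. -/
theorem ae_tendsto_reward (a₀ : ℝ) (ha : 0 ≤ a₀) :
    ∀ᵐ ω ∂P, Tendsto (fun n : ℕ => (∑ i ∈ Finset.range n,
        (ageBefore (fun i => X i ω) (fun i => S i ω) a₀ i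
          * timeInService (fun i => X i ω) (fun i => S i ω) i + X (i + 1) ω ^ 2 / 2)) / (n : ℝ)) atTop
      (𝓝 (1 / (r ^ 2 * p))) := by
  have hr := h.rate_pos
  have hp := h.p_pos
  filter_upwards [h.ae_tendsto_sum_ageBefore_mul a₀, h.ae_tendsto_sum_X_sq, h.ae_X_pos]
    with ω h1 h2 h3
  have h4 := tendsto_div_of_monotone_of_tendsto_sq (u := fun n => ∑ i ∈ Finset.range n,
        ageBefore (fun i => X i ω) (fun i => S i ω) a₀ i
          * timeInService (fun i => X i ω) (fun i => S i ω) i)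
    (monotone_nat_of_le_succ fun n => by
      rw [Finset.sum_range_succ]
      exact le_add_of_nonneg_right (mul_nonneg (ageBefore_nonneg h3 ha n)
        (timeInService_nonneg h3 (fun i => h.S_nonneg i ω) n))) h1
  have h5 := h4.add (h2.div_const 2)
  have hval : (1 - p) / (r ^ 2 * p) + 2 / r ^ 2 / 2 = 1 / (r ^ 2 * p) := by field_simp; ring
  rw [hval] at h5
  refine h5.congr fun n => ?_
  rw [Finset.sum_add_distrib, ← Finset.sum_div]
  ring

theorem ae_tendsto_average_age (a₀ : ℝ) (ha : 0 ≤ a₀) :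
    ∀ᵐ ω ∂P, Tendsto (fun τ : ℝ => 1 / τ * ∫ t in (0 : ℝ)..τ,
        age (fun i => X i ω) (fun i => S i ω) a₀ t) atTop (𝓝 (1 / (r * p))) := by
  have hr := h.rate_pos
  have hp := h.p_pos
  filter_upwards [h.ae_tendsto_reward a₀ ha, h.ae_tendsto_sum_X, h.ae_X_pos] with ω h1 h2 h3
  -- `arrivalTime` at `n` has `n + 1` summands; the extra `X 0` vanishes after division by `n`.
  have hT : Tendsto (fun n : ℕ => arrivalTime (fun i => X i ω) n / n) atTop (𝓝 (1 / r)) := by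
    have h4 := (tendsto_const_div_atTop_nhds_zero_nat (𝕜 := ℝ) (X 0 ω)).add h2
    rw [zero_add] at h4
    refine h4.congr fun n => ?_
    rw [arrivalTime, Finset.sum_range_succ']
    ring
  have h5 := tendsto_average_age h3 (fun i => h.S_nonneg i ω) ha (by positivity) hT h1
  have hval : 1 / (r ^ 2 * p) / (1 / r) = 1 / (r * p) := by field_simp
  rwa [hval] at h5

end IsRenewal

end Reward

/-! ### The HARQ system as a renewal model -/

section System

variable {Ω : Type*} {X : ℕ → Ω → ℝ} {E : ℕ → ℕ → Ω → Bool}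

/-- The σ-algebras generated by the individual interarrival times and symbol erasures. -/
abbrev systemAlgebra (X : ℕ → Ω → ℝ) (E : ℕ → ℕ → Ω → Bool) : ℕ ⊕ ℕ × ℕ → MeasurableSpace Ω :=
  Sum.elim (fun i => MeasurableSpace.comap (X i) inferInstance)
    (fun q => MeasurableSpace.comap (E q.1 q.2) inferInstance)

/-- The history up to the generation of update `i`. -/
abbrev history (X : ℕ → Ω → ℝ) (E : ℕ → ℕ → Ω → Bool) (i : ℕ) : MeasurableSpace Ω :=
  ⨆ a ∈ {a : ℕ ⊕ ℕ × ℕ | Sum.elim (fun j => j ≤ i) (fun q => q.1 < i) a}, systemAlgebra X E a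

lemma measurable_X_iSup {S : Set (ℕ ⊕ ℕ × ℕ)} {i : ℕ} (hi : Sum.inl i ∈ S) :
    Measurable[⨆ a ∈ S, systemAlgebra X E a] (X i) :=
  measurable_iff_comap_le.2 (le_iSup₂_of_le (f := fun a (_ : a ∈ S) => systemAlgebra X E a)
    (Sum.inl i) hi le_rfl)

lemma measurable_E_iSup {S : Set (ℕ ⊕ ℕ × ℕ)} {i : ℕ} (hi : ∀ j, Sum.inr (i, j) ∈ S) :
    Measurable[⨆ a ∈ S, systemAlgebra X E a] (fun ω j => E i j ω) := by
  refine @measurable_pi_lambda _ _ _ (_) _ _ fun j => ?_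
  exact measurable_iff_comap_le.2 (le_iSup₂_of_le
    (f := fun a (_ : a ∈ S) => systemAlgebra X E a) (Sum.inr (i, j)) (hi j) le_rfl)

lemma measurable_serviceTime {n_s k_s k_p : ℕ} (hkp : 1 ≤ k_p) :
    Measurable (serviceTime n_s k_s k_p) := by
  have h : Measurable fun m : ℕ => (n_s : ℝ) * (m : ℝ) := by fun_prop
  exact h.comp (measurable_numPackets hkp)

variable [mΩ : MeasurableSpace Ω] {P : Measure Ω} {lam δ : ℝ}

lemma systemAlgebra_le (h : IsFRSystem P lam δ X E) (a : ℕ ⊕ ℕ × ℕ) : systemAlgebra X E a ≤ mΩ := by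
  cases a with
  | inl i => exact (h.measurable_X i).comap_le
  | inr q => exact (h.measurable_E q.1 q.2).comap_le

lemma iIndep_systemAlgebra (h : IsFRSystem P lam δ X E) : iIndep (systemAlgebra X E) P := by
  refine iIndep_sumElim ((iIndepFun_iff_iIndep _ _ _).1 h.indep_X)
    ((iIndepFun_iff_iIndep _ _ _).1 h.indep_E) ?_
  refine indep_of_indep_of_le_left (indep_of_indep_of_le_right h.indep_X_E ?_) ?_
  · refine iSup_le fun q => Measurable.comap_le ?_
    have hm : Measurable fun e : ℕ → ℕ → Bool => e q.1 q.2 := by fun_prop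
    exact hm.comp (comap_measurable fun ω i j => E i j ω)
  · refine iSup_le fun i => Measurable.comap_le ?_
    exact (measurable_pi_apply i).comp (comap_measurable fun ω i => X i ω)

lemma IsFRSystem.indep_row (h : IsFRSystem P lam δ X E) (i : ℕ) : iIndepFun (E i) P :=
  h.indep_E.precomp (g := fun j : ℕ => (i, j)) (Prod.mk_right_injective i)

lemma isRenewal_system [IsProbabilityMeasure P] {n_s k_s k_p : ℕ} (hn : 1 ≤ n_s) (hkn : k_s ≤ n_s)
    (hkp : 1 ≤ k_p) (h0 : 0 ≤ δ) (h1 : δ < 1) (hlam : 0 < lam) (h : IsFRSystem P lam δ X E) :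
    IsRenewal P lam
      (((Real.exp (-lam * n_s) * (1 - packetErasureProb n_s k_s δ))
          / (1 - Real.exp (-lam * n_s) * packetErasureProb n_s k_s δ)) ^ k_p)
      X (fun i ω => serviceTime n_s k_s k_p (fun j => E i j ω)) (history X E) := by
  have hind := iIndep_systemAlgebra h
  have hle := systemAlgebra_le h
  have hST := measurable_serviceTime (n_s := n_s) (k_s := k_s) hkp
  refine
    { rate_pos := hlam
      p_pos := ?_
      mono := ?_
      le := fun i => iSup₂_le fun a _ => hle a
      measurable_X := fun i => measurable_X_iSup (show i ≤ i from le_rfl)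
      measurable_S := fun i => hST.comp (measurable_E_iSup fun j => Nat.lt_succ_self i)
      indep := fun i => ?_
      indep_S_X := fun i => ?_
      indep_X := h.indep_X
      law_X := h.law_X
      S_nonneg := fun i ω => by unfold serviceTime; positivity
      laplace_S := fun i => integral_exp_neg_serviceTime hn hkn hkp h0 h1 (h.measurable_E i)
        (h.prob_E i) (h.indep_row i) hlam }
  · have hε0 : 0 ≤ packetErasureProb n_s k_s δ := packetErasureProb_nonneg h0 h1
    have hε1 : packetErasureProb n_s k_s δ < 1 := packetErasureProb_lt_one hkn h0 h1
    have hz1 : Real.exp (-lam * n_s) ≤ 1 := by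
      rw [Real.exp_le_one_iff]
      have : 0 ≤ lam * n_s := by positivity
      linarith
    have e1 : 0 < 1 - packetErasureProb n_s k_s δ := by linarith
    have e2 : 0 < 1 - Real.exp (-lam * n_s) * packetErasureProb n_s k_s δ := by
      nlinarith [Real.exp_pos (-lam * n_s)]
    positivity
  · intro i j hij
    refine biSup_mono fun a ha => ?_
    cases a with
    | inl l => exact le_trans (show l ≤ i from ha) hij
    | inr q => exact lt_of_lt_of_le (show q.1 < i from ha) hij
  · have hd := indep_iSup_of_disjoint hle hind
      (S := {a : ℕ ⊕ ℕ × ℕ | Sum.elim (fun j => j ≤ i) (fun q => q.1 < i) a})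
      (T := {a : ℕ ⊕ ℕ × ℕ | Sum.elim (fun j => j = i + 1) (fun q => q.1 = i) a})
      (Set.disjoint_left.2 fun a ha hb => by
        cases a with
        | inl l => simp at ha hb; omega
        | inr q => simp at ha hb; omega)
    refine indep_of_indep_of_le_right hd (Measurable.comap_le ?_)
    exact (hST.comp (measurable_E_iSup fun j => show i = i from rfl)).prodMk
      (measurable_X_iSup (show i + 1 = i + 1 from rfl))
  · have hm1 : Measurable fun e : ℕ → ℕ → Bool => serviceTime n_s k_s k_p (e i) :=
      hST.comp (measurable_pi_apply i)
    exact (h.indep_X_E.comp (measurable_pi_apply (i + 1)) hm1).symm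

end System

end FRHARQ
end

/-! ### The main theorem -/

theorem mainTheorem7 (n_s k_s k_p : ℕ) (hks : 1 ≤ k_s) (hkn : k_s ≤ n_s) (hkp : 1 ≤ k_p)
    (δ : ℝ) (hδ0 : 0 ≤ δ) (hδ1 : δ < 1)
    (ε : ℝ) (hε : ε = FRHARQ.packetErasureProb n_s k_s δ) :
    -- law of the service time and average age
    (∀ (Ω : Type*) [MeasurableSpace Ω] (P : Measure Ω) [IsProbabilityMeasure P]
        (lam : ℝ) (X : ℕ → Ω → ℝ) (E : ℕ → ℕ → Ω → Bool),
        0 < lam → FRHARQ.IsFRSystem P lam δ X E →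
      (∀ i m : ℕ,
        P.real {ω | FRHARQ.serviceTime n_s k_s k_p (fun j => E i j ω)
            = (n_s : ℝ) * ((k_p + m : ℕ) : ℝ)}
          = ((k_p + m - 1).choose (k_p - 1) : ℝ) * (1 - ε) ^ k_p * ε ^ m) ∧
      ∀ a₀ : ℝ, 0 ≤ a₀ → ∀ᵐ ω ∂P,
        (∀ τ : ℝ, 0 ≤ τ → IntervalIntegrable
          (FRHARQ.age (fun i => X i ω)
            (fun i => FRHARQ.serviceTime n_s k_s k_p (fun j => E i j ω)) a₀) volume 0 τ) ∧
        Tendsto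
          (fun τ : ℝ => 1 / τ * ∫ t in (0 : ℝ)..τ,
            FRHARQ.age (fun i => X i ω)
              (fun i => FRHARQ.serviceTime n_s k_s k_p (fun j => E i j ω)) a₀ t)
          atTop (𝓝 (FRHARQ.agePFR n_s k_p ε lam))) ∧
    -- existence and uniqueness of the optimal arrival rate
    (∃! l : ℝ, FRHARQ.IsOptimalRate n_s k_p ε l) ∧
    -- `λ_FR` is the only positive root of the linearized optimality equation
    (∀ l : ℝ, (0 < l ∧ (1 + l * n_s) * (k_p * n_s * l - 1) = -ε) ↔
      l = FRHARQ.rateFR n_s k_p ε) ∧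
    -- bound on the optimal rate, its approximation by `λ_FR`, lower bound on the minimum age
    (∀ l : ℝ, FRHARQ.IsOptimalRate n_s k_p ε l →
      l ≤ 1 / (n_s * k_p) ∧
      Real.exp (l * n_s) * (k_p * n_s * l - 1) = -ε ∧
      FRHARQ.rateFR n_s k_p ε ≤ l ∧
      l - FRHARQ.rateFR n_s k_p ε ≤ ε / (k_p : ℝ) ^ 2 * l ∧
      1 / FRHARQ.rateFR n_s k_p ε * (1 + FRHARQ.rateFR n_s k_p ε * n_s / (1 - ε)) ^ k_p
        ≤ FRHARQ.agePFR n_s k_p ε l) := by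
  have hn : 1 ≤ n_s := hks.trans hkn
  have hε0 : 0 ≤ ε := hε ▸ FRHARQ.packetErasureProb_nonneg hδ0 hδ1
  have hε1 : ε < 1 := hε ▸ FRHARQ.packetErasureProb_lt_one hkn hδ0 hδ1
  refine ⟨?_, FRHARQ.existsUnique_isOptimalRate hn hkp hε0 hε1,
    FRHARQ.rateFR_iff hn hkp hε0 hε1, fun l hl => FRHARQ.optimalRate_bounds hn hkp hε0 hε1 hl⟩
  intro Ω _ P _ lam X E hlam h
  constructor
  · intro i m
    have hlaw := FRHARQ.measureReal_numPackets_eq (n_s := n_s) (k_s := k_s) hkp (h.measurable_E i)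
      (h.prob_E i) (h.indep_row i) m
    rw [hε, ← hlaw]
    congr 1
    ext ω
    have hn' : (n_s : ℝ) ≠ 0 := by positivity
    simp only [Set.mem_ofPred_eq, FRHARQ.serviceTime, mul_right_inj' hn', Nat.cast_inj]
  · intro a₀ ha
    have hren := FRHARQ.isRenewal_system hn hkn hkp hδ0 hδ1 hlam h
    filter_upwards [hren.ae_tendsto_average_age a₀ ha] with ω hω
    refine ⟨fun τ _ => FRHARQ.intervalIntegrable_age (fun i => hren.S_nonneg i ω) 0 τ, ?_⟩
    convert! hω using 2
    -- `agePFR` is `1 / (λ p)` with the reciprocal of the Laplace transform `p` moved inside the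
    -- power.
    rw [FRHARQ.agePFR, hε, one_div, one_div, mul_inv, ← inv_pow, inv_div]
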